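/- Let $n\in\{1,2\}$. There are a univariate real polynomial $p$, a bivariate real polynomial $q$ and a program $V$, all depending only on $n$, such that the following holds. Let $m\ge 0$, let $f_1,\dots,f_m\in\mathbb Z[x_1,\dots,x_n]$ have degree one, and let $$g(x)=\sum_{i=1}^n\left(a_ix_i^3+b_ix_i^2+c_ix_i+d_i\right)\in\mathbb Z[x_1,\dots,x_n]$$ with $a_i,b_i,c_i,d_i\in\mathbb Z$ and $a_i\neq 0$ for every $i$. Assume that the coefficients of the polynomials $g,f_1,\dots,f_m$ have absolute value at most $H$, and let $$R=\{x\in\mathbb R^n : g(x)\le 0,\ f_j(x)\le 0 \text{ for } j=1,\dots,m\}.$$ 1. If $R$ is nonempty, then $R$ contains a rational vector of size at most $p(\log H)$. 2. Such a vector is a certificate of feasibility that can be checked in polynomial time: for every $x\in\mathbb Q^n$, the program $V$, given the entries of $x$, the number $m$ and the coefficients of $g,f_1,\dots,f_m$, halts and correctly decides whether $x\in R$, and if $x$ has size at most $p(\log H)$, then it uses at most $q(m,\log H)$ bit operations. Here the size of a rational number $r/s$ in lowest terms with $s>0$ is $1+\lceil\log_2(|r|+1)\rceil+\lceil\log_2(s+1)\rceil$,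 and the size of $x\in\mathbb Q^n$ is $n$ plus the sum of the sizes of its entries. Programs run on a register machine that reads a list of integers from a one-way input tape, stores integers in finitely many registers, adds, subtracts, multiplies, and branches and loops on the positivity of a register. With $1+\lceil\log_2(|z|+1)\rceil$ the size of an integer $z$, writing a constant, reading an integer and testing a register cost the size of the integer involved, an addition or subtraction costs the sum of the sizes of its operands, and a multiplication costs the product of their sizes; a no-op costs 1. -/

import Mathlib

/-- Size (bit encoding length) of an integer: `1 + ⌈log₂ (|z| + 1)⌉`. -/
def intSize (z : ℤ) : ℕ := 1 + Nat.clog 2 (z.natAbs + 1)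

/-- Size of a rational number `p / q` in lowest terms with `q > 0`:
`1 + ⌈log₂ (|p| + 1)⌉ + ⌈log₂ (q + 1)⌉`. -/
def ratSize (r : ℚ) : ℕ := 1 + Nat.clog 2 (r.num.natAbs + 1) + Nat.clog 2 (r.den + 1)

/-- Size of a rational vector: its dimension plus the sizes of its entries. -/
def vecSize {n : ℕ} (x : Fin n → ℚ) : ℕ := n + ∑ i, ratSize (x i)

/-- The separable cubic `∑ i, (aᵢ xᵢ³ + bᵢ xᵢ² + cᵢ xᵢ + dᵢ)`. -/
noncomputable def separableCubic {n : ℕ} (a b c d : Fin n → ℤ) : MvPolynomial (Fin n) ℤ :=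
  ∑ i, (MvPolynomial.C (a i) * MvPolynomial.X i ^ 3 + MvPolynomial.C (b i) * MvPolynomial.X i ^ 2
    + MvPolynomial.C (c i) * MvPolynomial.X i + MvPolynomial.C (d i))

/-- `{x ∈ ℝⁿ | g(x) ≤ 0, fᵢ(x) ≤ 0 for all i}`. -/
def feasibleSet {n m : ℕ} (g : MvPolynomial (Fin n) ℤ) (f : Fin m → MvPolynomial (Fin n) ℤ) :
    Set (Fin n → ℝ) :=
  {x | MvPolynomial.aeval x g ≤ 0 ∧ ∀ i, MvPolynomial.aeval x (f i) ≤ 0}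

/-- The absolute values of all coefficients of a polynomial are at most `H`. -/
def CoeffsBoundedBy {n : ℕ} (H : ℝ) (g : MvPolynomial (Fin n) ℤ) : Prop :=
  ∀ e : Fin n →₀ ℕ, |((g.coeff e : ℤ) : ℝ)| ≤ H

/-- Programs for a register machine. It has integer registers (a program mentions only finitely
many of them) and a one-way input tape holding a finite list of integers. -/
inductive BitProgram : Type
  | skip : BitProgram
  /-- `r := z` -/
  | const (r : ℕ) (z : ℤ) : BitProgram
  /-- `r :=` the next integer of the input tape (`0` if the tape is exhausted) -/
  | read (r : ℕ) : BitProgram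
  /-- `r := s + t` -/
  | add (r s t : ℕ) : BitProgram
  /-- `r := s - t` -/
  | sub (r s t : ℕ) : BitProgram
  /-- `r := s * t` -/
  | mul (r s t : ℕ) : BitProgram
  | seq (P Q : BitProgram) : BitProgram
  /-- `if r > 0 then P else Q` -/
  | ifPos (r : ℕ) (P Q : BitProgram) : BitProgram
  /-- `while r > 0 do P` -/
  | whilePos (r : ℕ) (P : BitProgram) : BitProgram

namespace BitProgram

/-- A configuration: the contents of the registers and the unread part of the input tape. -/
structure State : Type where
  reg : ℕ → ℤ
  tape : List ℤ

/-- The configuration `σ` with register `r` overwritten by `z`. -/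
def State.set (σ : State) (r : ℕ) (z : ℤ) : State := ⟨Function.update σ.reg r z, σ.tape⟩

/-- `Exec P σ t τ`: started in `σ`, the program `P` halts in `τ` after `t` bit operations.
Every instruction is charged for all the bits it handles: writing a constant, reading an input
integer and testing a register cost the size of the integer, an addition or subtraction costs the
sum of the sizes of the operands, and a multiplication costs their product. -/
inductive Exec : BitProgram → State → ℕ → State → Prop
  | skip (σ : State) : Exec .skip σ 1 σ
  | const (σ : State) (r : ℕ) (z : ℤ) : Exec (.const r z) σ (intSize z) (σ.set r z)
  | read (σ : State) (r : ℕ) :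
      Exec (.read r) σ (intSize (σ.tape.headD 0))
        ⟨Function.update σ.reg r (σ.tape.headD 0), σ.tape.tail⟩
  | add (σ : State) (r s t : ℕ) :
      Exec (.add r s t) σ (intSize (σ.reg s) + intSize (σ.reg t)) (σ.set r (σ.reg s + σ.reg t))
  | sub (σ : State) (r s t : ℕ) :
      Exec (.sub r s t) σ (intSize (σ.reg s) + intSize (σ.reg t)) (σ.set r (σ.reg s - σ.reg t))
  | mul (σ : State) (r s t : ℕ) :
      Exec (.mul r s t) σ (intSize (σ.reg s) * intSize (σ.reg t)) (σ.set r (σ.reg s * σ.reg t))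
  | seq {P Q : BitProgram} {σ τ υ : State} {t u : ℕ} :
      Exec P σ t τ → Exec Q τ u υ → Exec (.seq P Q) σ (t + u) υ
  | ifPos_true {r : ℕ} {P Q : BitProgram} {σ τ : State} {t : ℕ} :
      0 < σ.reg r → Exec P σ t τ → Exec (.ifPos r P Q) σ (intSize (σ.reg r) + t) τ
  | ifPos_false {r : ℕ} {P Q : BitProgram} {σ τ : State} {t : ℕ} :
      ¬ 0 < σ.reg r → Exec Q σ t τ → Exec (.ifPos r P Q) σ (intSize (σ.reg r) + t) τ
  | while_true {r : ℕ} {P : BitProgram} {σ τ υ : State} {t u : ℕ} :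
      0 < σ.reg r → Exec P σ t τ → Exec (.whilePos r P) τ u υ →
      Exec (.whilePos r P) σ (intSize (σ.reg r) + t + u) υ
  | while_false {r : ℕ} {P : BitProgram} {σ : State} :
      ¬ 0 < σ.reg r → Exec (.whilePos r P) σ (intSize (σ.reg r)) σ

/-- On the given input tape, with all registers initially `0`, the program halts after exactly `t`
bit operations, and it accepts (register `0` is positive at the end) if and only if `A` holds. -/
def DecidesIn (P : BitProgram) (input : List ℤ) (A : Prop) (t : ℕ) : Prop :=
  ∃ τ : State, P.Exec ⟨fun _ => 0, input⟩ t τ ∧ (0 < τ.reg 0 ↔ A)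

end BitProgram

/-- The input tape that presents a rational vector `x` together with the instance `(g, f)`: the
numerators and denominators of the entries of `x`, the number `m` of linear inequalities, the
coefficients of `xᵢ³`, `xᵢ²`, `xᵢ` in `g` for every `i` and the constant term of `g`, and, for each
`fⱼ`, the coefficients of all `xᵢ` and the constant term. -/
noncomputable def certificateInput {n m : ℕ} (x : Fin n → ℚ) (g : MvPolynomial (Fin n) ℤ)
    (f : Fin m → MvPolynomial (Fin n) ℤ) : List ℤ :=
  (List.ofFn fun i => [(x i).num, ((x i).den : ℤ)]).flatten
    ++ [(m : ℤ)]
    ++ (List.ofFn fun i => [g.coeff (Finsupp.single i 3), g.coeff (Finsupp.single i 2),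
        g.coeff (Finsupp.single i 1)]).flatten
    ++ [g.coeff 0]
    ++ (List.ofFn fun j =>
        (List.ofFn fun i => (f j).coeff (Finsupp.single i 1)) ++ [(f j).coeff 0]).flatten

/-!
A separable cubic `g₁(x) + g₂(y)` is minimized one coordinate at a time. Starting from a feasible
point, `y` is moved vertically to a minimizer of `g₂` on the fiber of the polyhedron cut out by the
linear inequalities, then `x` is moved horizontally to a minimizer of `g₁`. Up to reflections the
leading coefficients are positive, so there are three possible outcomes.

* Nothing bounds the polyhedron in a coordinate direction in which the cubic tends to `-∞`. Then
  going far enough in that direction gives a solution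
  (`CubicSystem.hasSmallSolution_of_unbounded`).
* A point on a constraint line is reached. Eliminating a variable leaves a univariate system
  (`CubicSystem.hasSmallSolution_of_linear_eq_zero`, `exists_small_solution_of_univariate`), which
  is treated in the same way on a line instead of a plane.
* A local minimum `(x, y)` of the cubic is reached, with `x = (s₁ - b₁) / (3a₁)`,
  `y = (s₂ - b₂) / (3a₂)`, where `s₁` and `s₂` are square roots of integers. All quantities of
  interest have the form `u + v + r` with `u²`, `v²`, `r` integers, hence are zero or at least a
  power of `1 / H` in absolute value (`add_add_le_neg_of_sq_eq_int`). If the minimal value is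
  negative, rounding `x` and `y` to multiples of a power of `1 / H` preserves all the inequalities.
  If it is zero, then `s₁` and `s₂` are integers, because a minimal value of a cubic contains its
  square root with a negative coefficient, so the two square roots cannot cancel
  (`exists_int_eq_of_mul_add_mul_eq`). This is `CubicSystem.hasSmallSolution_of_critical`.

In every case the coordinates are quotients of integers bounded by a fixed power of `H`, so the size
of the solution is linear in `log H`.

The verifier evaluates all the inequalities at the given point after clearing denominators. It
consists of a loop-free program for the cubic and a loop whose loop-free body treats one linear
inequality. A fixed loop-free program takes time quadratic in the size of its data
(`BitProgram.LoopFree.exists_exec_le`), and as the working registers are cleared after every round,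
all rounds start from data of the same size.
-/

/-! ### Heights and square roots of integers -/

/-- `x` is a quotient of integers of absolute value at most `B`. -/
def HeightLE (B : ℤ) (x : ℝ) : Prop :=
  ∃ N D : ℤ, 0 < D ∧ |N| ≤ B ∧ D ≤ B ∧ x = N / D

theorem HeightLE.mono {B B' : ℤ} {x : ℝ} (h : HeightLE B x) (hB : B ≤ B') : HeightLE B' x := by
  obtain ⟨N, D, h1, h2, h3, h4⟩ := h
  exact ⟨N, D, h1, h2.trans hB, h3.trans hB, h4⟩

theorem HeightLE.of_div {B N D : ℤ} {x : ℝ} (hD : D ≠ 0) (hN : |N| ≤ B) (hDB : |D| ≤ B)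
    (hx : x = N / D) : HeightLE B x := by
  rcases lt_or_gt_of_ne hD with h | h
  · refine ⟨-N, -D, by omega, by rwa [abs_neg], ?_, ?_⟩
    · rwa [abs_of_neg h] at hDB
    · rw [hx]; push_cast; rw [neg_div_neg_eq]
  · exact ⟨N, D, h, hN, (le_abs_self D).trans hDB, hx⟩

theorem HeightLE.intCast {B N : ℤ} (hN : |N| ≤ B) (hB : 1 ≤ B) : HeightLE B (N : ℝ) :=
  ⟨N, 1, one_pos, hN, hB, by simp⟩

theorem HeightLE.abs_le {B : ℤ} {x : ℝ} (h : HeightLE B x) : |x| ≤ B := by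
  obtain ⟨N, D, h1, h2, h3, h4⟩ := h
  have hD : (1 : ℝ) ≤ D := by exact_mod_cast h1
  have hN : |(N : ℝ)| ≤ B := by exact_mod_cast h2
  rw [h4, abs_div, abs_of_pos (by linarith : (0 : ℝ) < D)]
  exact (div_le_self (abs_nonneg _) hD).trans hN

theorem HeightLE.neg {B : ℤ} {x : ℝ} (h : HeightLE B x) : HeightLE B (-x) := by
  obtain ⟨N, D, h1, h2, h3, h4⟩ := h
  exact ⟨-N, D, h1, by rwa [abs_neg], h3, by rw [h4]; push_cast; ring⟩

theorem abs_mul_le_mul_of_abs_le {R : Type*} [CommRing R] [LinearOrder R] [IsStrictOrderedRing R]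
    {a b X Y : R} (ha : |a| ≤ X) (hb : |b| ≤ Y) : |a * b| ≤ X * Y := by
  rw [abs_mul]
  exact mul_le_mul ha hb (abs_nonneg _) ((abs_nonneg _).trans ha)

theorem abs_pow_le_pow_of_abs_le {R : Type*} [CommRing R] [LinearOrder R] [IsStrictOrderedRing R]
    {a X : R} (ha : |a| ≤ X) (k : ℕ) : |a ^ k| ≤ X ^ k := by
  rw [abs_pow]
  exact pow_le_pow_left₀ (abs_nonneg _) ha k

/-- A nonzero number `u + v + r`, where `u` and `v` are square roots of integers, is bounded away
from zero: the product of its four conjugates is an integer, and where that product vanishes,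
`u + v + r` is one of `2 * u`, `2 * v`, `2 * r`. -/
theorem add_add_le_neg_of_sq_eq_int {u v T : ℝ} {U V r : ℤ} (hu : u ^ 2 = U) (hv : v ^ 2 = V)
    (hT : 1 ≤ T) (huT : |u| ≤ T) (hvT : |v| ≤ T) (hrT : |(r : ℝ)| ≤ T)
    (hneg : u + v + r < 0) : u + v + r ≤ -(1 / (27 * T ^ 3)) := by
  have hT3 : (1 : ℝ) ≤ T ^ 3 := one_le_pow₀ hT
  have hsmall : 1 / (27 * T ^ 3) ≤ 1 := by
    rw [div_le_one (by positivity)]; linarith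
  have sq_case : ∀ Z : ℤ, (u + v + r) ^ 2 = Z → u + v + r ≤ -(1 / (27 * T ^ 3)) := by
    intro Z hZ
    have h0 : (0 : ℝ) < Z := by rw [← hZ]; rw [sq]; exact mul_pos_of_neg_of_neg hneg hneg
    have h1 : (1 : ℝ) ≤ Z := by exact_mod_cast (by exact_mod_cast h0 : (0 : ℤ) < Z)
    have : u + v + r ≤ -1 := by nlinarith
    linarith
  have hprod : (u + v + r) * ((u - v + r) * (-u + v + r) * (-u - v + r))
      = (((r ^ 2 + U - V) ^ 2 - 4 * r ^ 2 * U : ℤ) : ℝ) := by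
    push_cast; rw [← hu, ← hv]; ring
  set Z : ℤ := (r ^ 2 + U - V) ^ 2 - 4 * r ^ 2 * U with hZdef
  by_cases hZ : Z = 0
  · rw [hZ, Int.cast_zero] at hprod
    rcases mul_eq_zero.1 hprod with h | h
    · exact absurd h hneg.ne
    rcases mul_eq_zero.1 h with h | h
    rcases mul_eq_zero.1 h with h | h
    · apply sq_case (4 * V); push_cast; rw [← hv, show u + v + r = 2 * v by linarith]; ring
    · apply sq_case (4 * U); push_cast; rw [← hu, show u + v + r = 2 * u by linarith]; ring
    · apply sq_case (4 * r ^ 2); push_cast; rw [show u + v + r = 2 * r by linarith]; ring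
  · have h1 : (1 : ℝ) ≤ |(Z : ℝ)| := by exact_mod_cast Int.one_le_abs hZ
    rw [abs_le] at huT hvT hrT
    have b1 : |u - v + r| ≤ 3 * T := abs_le.2 ⟨by linarith, by linarith⟩
    have b2 : |-u + v + r| ≤ 3 * T := abs_le.2 ⟨by linarith, by linarith⟩
    have b3 : |-u - v + r| ≤ 3 * T := abs_le.2 ⟨by linarith, by linarith⟩
    have b4 := abs_mul_le_mul_of_abs_le (abs_mul_le_mul_of_abs_le b1 b2) b3
    rw [← hprod, abs_mul, abs_of_neg hneg] at h1
    have h2 : 1 ≤ -(u + v + r) * (27 * T ^ 3) := by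
      refine h1.trans ?_
      have := mul_le_mul_of_nonneg_left b4 (by linarith : 0 ≤ -(u + v + r))
      linarith [this, (by ring : 3 * T * (3 * T) * (3 * T) = 27 * T ^ 3)]
    have h3 : 1 / (27 * T ^ 3) ≤ -(u + v + r) := by
      rw [div_le_iff₀ (by positivity)]; exact h2
    linarith

/-- The terms `p * s` and `q * t` cannot cancel, so their sum `r` is positive; dividing the rational
number `(p * s) ^ 2 - (q * t) ^ 2` by `r` shows that `p * s - q * t`, hence `s`, is rational. -/
theorem exists_int_eq_of_mul_add_mul_eq {s t : ℝ} {S T p q r : ℤ} (hs : 0 < s) (ht : 0 ≤ t)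
    (hS : s ^ 2 = S) (hT : t ^ 2 = T) (hp : 0 < p) (hq : 0 ≤ q) (h : p * s + q * t = r) :
    ∃ z : ℤ, s = z := by
  have hp' : (0 : ℝ) < p := by exact_mod_cast hp
  have hq' : (0 : ℝ) ≤ q := by exact_mod_cast hq
  have hr : (0 : ℝ) < r := by rw [← h]; positivity
  have hrat : s =
      ((((r ^ 2 + p ^ 2 * S - q ^ 2 * T : ℤ) : ℚ) / ((2 * r * p : ℤ) : ℚ) : ℚ) : ℝ) := by
    push_cast
    rw [eq_div_iff (by positivity), ← h, ← hS, ← hT]; ring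
  by_contra hcon
  push Not at hcon
  have : Irrational s := irrational_nrt_of_notint_nrt 2 S hS (by rintro ⟨y, hy⟩; exact hcon y hy)
    (by norm_num)
  exact this ⟨_, hrat.symm⟩

/-! ### Planar systems and critical points of separable cubics -/

/-- A planar system `a₁x³ + b₁x² + c₁x + a₂y³ + b₂y² + c₂y + e ≤ 0`, `αⱼx + βⱼy + γⱼ ≤ 0`
(`j < m`) with integer coefficients. -/
structure CubicSystem (m : ℕ) where
  (a₁ b₁ c₁ a₂ b₂ c₂ e : ℤ)
  (α β γ : Fin m → ℤ)

namespace CubicSystem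

variable {m : ℕ}

/-- The value of the separable cubic of the system. -/
def cubic (S : CubicSystem m) (x y : ℝ) : ℝ :=
  S.a₁ * x ^ 3 + S.b₁ * x ^ 2 + S.c₁ * x + (S.a₂ * y ^ 3 + S.b₂ * y ^ 2 + S.c₂ * y) + S.e

/-- The value of the linear form with index `j`. -/
def linear (S : CubicSystem m) (j : Fin m) (x y : ℝ) : ℝ :=
  S.α j * x + S.β j * y + S.γ j

/-- The point `(x, y)` satisfies all inequalities of the system. -/
def Feasible (S : CubicSystem m) (x y : ℝ) : Prop :=
  S.cubic x y ≤ 0 ∧ ∀ j, S.linear j x y ≤ 0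

/-- All coefficients of the system have absolute value at most `H`. -/
structure BoundedBy (S : CubicSystem m) (H : ℤ) : Prop where
  a₁ : |S.a₁| ≤ H
  b₁ : |S.b₁| ≤ H
  c₁ : |S.c₁| ≤ H
  a₂ : |S.a₂| ≤ H
  b₂ : |S.b₂| ≤ H
  c₂ : |S.c₂| ≤ H
  e : |S.e| ≤ H
  α : ∀ j, |S.α j| ≤ H
  β : ∀ j, |S.β j| ≤ H
  γ : ∀ j, |S.γ j| ≤ H

/-- The system has a solution with coordinates of height at most `B`. -/
def HasSmallSolution (S : CubicSystem m) (B : ℤ) : Prop :=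
  ∃ x y, S.Feasible x y ∧ HeightLE B x ∧ HeightLE B y

theorem HasSmallSolution.mono {S : CubicSystem m} {B B' : ℤ} (h : S.HasSmallSolution B)
    (hB : B ≤ B') : S.HasSmallSolution B' := by
  obtain ⟨x, y, h1, h2, h3⟩ := h
  exact ⟨x, y, h1, h2.mono hB, h3.mono hB⟩

end CubicSystem

/-- The Taylor expansion of a cubic at its critical point `(s - b) / (3 * a)`. -/
theorem cubic_add_at_critical {a b c s h x : ℝ} (ha : a ≠ 0) (hs : s ^ 2 = b ^ 2 - 3 * a * c)
    (hx : x = (s - b) / (3 * a)) :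
    a * (x + h) ^ 3 + b * (x + h) ^ 2 + c * (x + h)
      = a * x ^ 3 + b * x ^ 2 + c * x + (s * h ^ 2 + a * h ^ 3) := by
  have h1 : 3 * a * x + b = s := by rw [hx]; field_simp; ring
  have h2 : 3 * a * (3 * a * x ^ 2 + 2 * b * x + c) = 0 := by rw [← h1] at hs; linarith
  have h3 : 3 * a * x ^ 2 + 2 * b * x + c = 0 := by
    rcases mul_eq_zero.1 h2 with h | h
    · exact absurd h (by simpa using ha)
    · exact h
  rw [← h1]; linear_combination h * h3

/-- The value of a cubic at its critical point `(s - b) / (3 * a)`. -/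
theorem cubic_at_critical {a b c s x : ℝ} (ha : a ≠ 0) (hs : s ^ 2 = b ^ 2 - 3 * a * c)
    (hx : x = (s - b) / (3 * a)) :
    27 * a ^ 2 * (a * x ^ 3 + b * x ^ 2 + c * x)
      = -2 * (b ^ 2 - 3 * a * c) * s + (2 * b ^ 3 - 9 * a * b * c) := by
  have h1 : 3 * a * x = s - b := by rw [hx]; field_simp
  have h2 : 27 * a ^ 2 * (a * x ^ 3 + b * x ^ 2 + c * x)
      = (3 * a * x) ^ 3 + 3 * b * (3 * a * x) ^ 2 + 9 * a * c * (3 * a * x) := by ring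
  rw [h2, h1]; linear_combination (s) * hs

/-- Rounding down to a multiple of `1 / Δ`. -/
theorem exists_small_heightLE {H X : ℤ} {Δ x : ℝ} {k : ℕ} (hH : 2 ≤ H) (hΔ : Δ = (H : ℝ) ^ k)
    (hX : 1 ≤ X) (hx : |x| ≤ X) :
    ∃ h : ℝ, |h| ≤ 1 / Δ ∧ HeightLE (X * H ^ (k + 1)) (x + h) := by
  have hH' : (2 : ℝ) ≤ H := by exact_mod_cast hH
  have hΔ1 : (1 : ℝ) ≤ Δ := by rw [hΔ]; exact one_le_pow₀ (by linarith)
  have hΔ0 : (0 : ℝ) < Δ := by linarith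
  have hfl := Int.floor_le (x * Δ)
  have hfl' := Int.lt_floor_add_one (x * Δ)
  have hk : (1 : ℤ) ≤ H ^ k := one_le_pow₀ (by linarith)
  refine ⟨(⌊x * Δ⌋ : ℝ) / Δ - x, ?_, ⌊x * Δ⌋, H ^ k, by positivity, ?_, ?_, ?_⟩
  · have : (⌊x * Δ⌋ : ℝ) / Δ - x = -((x * Δ - ⌊x * Δ⌋) / Δ) := by field_simp; ring
    rw [this, abs_neg, abs_div, abs_of_pos hΔ0]
    apply div_le_div_of_nonneg_right _ hΔ0.le
    rw [abs_le]; constructor <;> linarith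
  · have h1 : |((⌊x * Δ⌋ : ℤ) : ℝ)| ≤ X * Δ + 1 := by
      have h2 : |x * Δ| ≤ X * Δ := by
        rw [abs_mul, abs_of_pos hΔ0]; exact mul_le_mul_of_nonneg_right hx hΔ0.le
      rw [abs_le] at h2 ⊢
      constructor <;> linarith
    have h2 : ((|⌊x * Δ⌋| : ℤ) : ℝ) ≤ X * H ^ k + 1 := by rw [← hΔ, Int.cast_abs]; exact h1
    have h3 : |⌊x * Δ⌋| ≤ X * H ^ k + 1 := by exact_mod_cast h2
    have h4 : X * H ^ k * 2 ≤ X * H ^ k * H := mul_le_mul_of_nonneg_left hH (by positivity)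
    have h5 : 1 ≤ X * H ^ k := by nlinarith
    rw [pow_succ, ← mul_assoc]; linarith
  · have h1 : H ^ k * 1 ≤ H ^ k * H := mul_le_mul_of_nonneg_left (by linarith) (by positivity)
    have h2 : 1 * (H ^ k * H) ≤ X * (H ^ k * H) := mul_le_mul_of_nonneg_right hX (by positivity)
    rw [pow_succ]; linarith
  · push_cast; rw [hΔ]; ring

theorem pow_mul_pow_le_of_two_le {H : ℝ} (hH : 2 ≤ H) {c : ℝ} {i j : ℕ} (hc : c ≤ 2 ^ i) :
    c * H ^ j ≤ H ^ (i + j) := by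
  rw [pow_add]
  apply mul_le_mul_of_nonneg_right _ (by positivity)
  exact hc.trans (pow_le_pow_left₀ (by norm_num) hH i)

namespace CubicSystem

variable {m : ℕ}

set_option maxHeartbeats 1000000 in
/-- A feasible local minimum `((s₁ - b₁) / (3a₁), (s₂ - b₂) / (3a₂))` of the cubic which lies on no
constraint line gives a small rational solution. In the formula for `27a₁²a₂²` times the minimal
value, the square roots `s₁` and `s₂` have coefficients of the same sign, so a minimal value `0`
forces them to be integers. A negative minimal value and the slacks of the constraints are at least
a power of `1 / H`, which leaves room for rounding. -/
theorem hasSmallSolution_of_critical {S : CubicSystem m} {H : ℤ} (hH : 2 ≤ H) (hS : S.BoundedBy H)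
    (ha₁ : S.a₁ ≠ 0) (ha₂ : S.a₂ ≠ 0) {s₁ s₂ x y : ℝ} (hs₁ : 0 ≤ s₁) (hs₂ : 0 ≤ s₂)
    (hD₁ : s₁ ^ 2 = S.b₁ ^ 2 - 3 * S.a₁ * S.c₁) (hD₂ : s₂ ^ 2 = S.b₂ ^ 2 - 3 * S.a₂ * S.c₂)
    (hx : x = (s₁ - S.b₁) / (3 * S.a₁)) (hy : y = (s₂ - S.b₂) / (3 * S.a₂))
    (hf : S.Feasible x y) (hstrict : ∀ j, S.linear j x y < 0 ∨ (S.α j = 0 ∧ S.β j = 0)) :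
    S.HasSmallSolution (H ^ 51) := by
  obtain ⟨hg, hl⟩ := hf
  have hH' : (2 : ℝ) ≤ H := by exact_mod_cast hH
  have hA₁ : (S.a₁ : ℝ) ≠ 0 := by exact_mod_cast ha₁
  have hA₂ : (S.a₂ : ℝ) ≠ 0 := by exact_mod_cast ha₂
  have bA₁ : |(S.a₁ : ℝ)| ≤ H := by exact_mod_cast hS.a₁
  have bB₁ : |(S.b₁ : ℝ)| ≤ H := by exact_mod_cast hS.b₁
  have bC₁ : |(S.c₁ : ℝ)| ≤ H := by exact_mod_cast hS.c₁
  have bA₂ : |(S.a₂ : ℝ)| ≤ H := by exact_mod_cast hS.a₂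
  have bB₂ : |(S.b₂ : ℝ)| ≤ H := by exact_mod_cast hS.b₂
  have bC₂ : |(S.c₂ : ℝ)| ≤ H := by exact_mod_cast hS.c₂
  have bE : |(S.e : ℝ)| ≤ H := by exact_mod_cast hS.e
  have lA₁ : (1 : ℝ) ≤ |(S.a₁ : ℝ)| := by exact_mod_cast Int.one_le_abs ha₁
  have lA₂ : (1 : ℝ) ≤ |(S.a₂ : ℝ)| := by exact_mod_cast Int.one_le_abs ha₂
  have bs : ∀ {s a b c : ℝ}, 0 ≤ s → |a| ≤ H → |b| ≤ H → |c| ≤ H → s ^ 2 = b ^ 2 - 3 * a * c →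
      s ≤ 2 * H := by
    intro s a b c hs ha hb hc h
    have h1 := abs_le.1 (abs_mul_le_mul_of_abs_le ha hc)
    have h2 := abs_le.1 (abs_pow_le_pow_of_abs_le hb 2)
    have h3 : s ^ 2 ≤ (2 * H) ^ 2 := by nlinarith
    exact (sq_le_sq₀ hs (by linarith)).1 h3
  have bs₁ := bs hs₁ bA₁ bB₁ bC₁ hD₁
  have bs₂ := bs hs₂ bA₂ bB₂ bC₂ hD₂
  have bx : ∀ {s a b x : ℝ}, 0 ≤ s → s ≤ 2 * H → |b| ≤ H → 1 ≤ |a| → x = (s - b) / (3 * a) →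
      |x| ≤ H := by
    intro s a b x hs hs' hb ha hx
    rw [hx, abs_div, abs_mul, abs_of_pos (by norm_num : (0 : ℝ) < 3), div_le_iff₀ (by linarith)]
    rw [abs_le] at hb
    have : |s - b| ≤ 3 * H := abs_le.2 ⟨by linarith, by linarith⟩
    nlinarith
  have bx₁ := bx hs₁ bs₁ bB₁ lA₁ hx
  have bx₂ := bx hs₂ bs₂ bB₂ lA₂ hy
  have bs₁' : |s₁| ≤ 2 * H := by rwa [abs_of_nonneg hs₁]
  have bs₂' : |s₂| ≤ 2 * H := by rwa [abs_of_nonneg hs₂]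
  set D₁ : ℤ := S.b₁ ^ 2 - 3 * S.a₁ * S.c₁ with hD₁'
  set D₂ : ℤ := S.b₂ ^ 2 - 3 * S.a₂ * S.c₂ with hD₂'
  have hsD₁ : s₁ ^ 2 = D₁ := by rw [hD₁, hD₁']; push_cast; ring
  have hsD₂ : s₂ ^ 2 = D₂ := by rw [hD₂, hD₂']; push_cast; ring
  have bD₁ : |(D₁ : ℝ)| ≤ (2 * H) ^ 2 := by rw [← hsD₁]; exact abs_pow_le_pow_of_abs_le bs₁' 2
  have bD₂ : |(D₂ : ℝ)| ≤ (2 * H) ^ 2 := by rw [← hsD₂]; exact abs_pow_le_pow_of_abs_le bs₂' 2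
  set Γ : ℤ := S.a₂ ^ 2 * (2 * S.b₁ ^ 3 - 9 * (S.a₁ * S.b₁ * S.c₁))
    + S.a₁ ^ 2 * (2 * S.b₂ ^ 3 - 9 * (S.a₂ * S.b₂ * S.c₂))
    + 27 * (S.a₁ ^ 2 * S.a₂ ^ 2 * S.e) with hΓ
  have hval : 27 * ((S.a₁ : ℝ) ^ 2 * S.a₂ ^ 2) * S.cubic x y
      = -2 * (D₁ * s₁ * S.a₂ ^ 2) + -2 * (D₂ * s₂ * S.a₁ ^ 2) + Γ := by
    have e₁ := cubic_at_critical hA₁ hD₁ hx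
    have e₂ := cubic_at_critical hA₂ hD₂ hy
    rw [hΓ, hD₁', hD₂']; push_cast
    unfold cubic
    linear_combination (S.a₂ : ℝ) ^ 2 * e₁ + (S.a₁ : ℝ) ^ 2 * e₂
  -- `49 = 11 + 11 + 27` bounds the sum of the coefficients in `Γ`, which has degree five
  set T : ℝ := 49 * (H : ℝ) ^ 5 with hT
  have hH5 : (1 : ℝ) ≤ (H : ℝ) ^ 5 := one_le_pow₀ (by linarith)
  have hT1 : 1 ≤ T := by linarith
  have hH4 : (1 : ℝ) ≤ (H : ℝ) ^ 4 := one_le_pow₀ (by linarith)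
  have P1 : (1 : ℝ) ≤ S.a₁ ^ 2 * S.a₂ ^ 2 := by
    rw [← sq_abs (S.a₁ : ℝ), ← sq_abs (S.a₂ : ℝ)]
    exact one_le_mul_of_one_le_of_one_le (one_le_pow₀ lA₁) (one_le_pow₀ lA₂)
  have P2 : (S.a₁ : ℝ) ^ 2 * S.a₂ ^ 2 ≤ H ^ 4 := by
    have := abs_mul_le_mul_of_abs_le (abs_pow_le_pow_of_abs_le bA₁ 2)
      (abs_pow_le_pow_of_abs_le bA₂ 2)
    exact (le_abs_self _).trans (this.trans (by ring_nf; rfl))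
  have hTH : 27 * T ^ 3 ≤ (H : ℝ) ^ 38 := by
    have := pow_mul_pow_le_of_two_le hH' (c := 27 * 49 ^ 3) (i := 23) (j := 15) (by norm_num)
    calc 27 * T ^ 3 = 27 * 49 ^ 3 * (H : ℝ) ^ 15 := by rw [hT]; ring
      _ ≤ _ := this
  -- a negative quantity that becomes an admissible sum of square roots after clearing denominators
  have hsep : ∀ w : ℝ, 27 * ((S.a₁ : ℝ) ^ 2 * S.a₂ ^ 2) * w ≤ -(1 / (27 * T ^ 3)) →
      w ≤ -(1 / (H : ℝ) ^ 47) := by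
    intro w hw
    have h1 : 1 / (H : ℝ) ^ 38 ≤ 1 / (27 * T ^ 3) := one_div_le_one_div_of_le (by positivity) hTH
    have h2 : 27 * (H : ℝ) ^ 4 ≤ H ^ 9 :=
      pow_mul_pow_le_of_two_le hH' (i := 5) (by norm_num)
    have hpos : (0 : ℝ) < 1 / H ^ 47 := by positivity
    by_contra hcon
    push Not at hcon
    have h3 : 27 * ((S.a₁ : ℝ) ^ 2 * S.a₂ ^ 2) * (-(1 / (H : ℝ) ^ 47))
        < 27 * ((S.a₁ : ℝ) ^ 2 * S.a₂ ^ 2) * w :=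
      mul_lt_mul_of_pos_left hcon (by linarith)
    have h4 : 27 * ((S.a₁ : ℝ) ^ 2 * S.a₂ ^ 2) * (1 / (H : ℝ) ^ 47)
        ≤ H ^ 9 * (1 / (H : ℝ) ^ 47) := mul_le_mul_of_nonneg_right (by linarith) hpos.le
    have h5 : (H : ℝ) ^ 9 * (1 / (H : ℝ) ^ 47) = 1 / (H : ℝ) ^ 38 := by field_simp
    linarith
  rcases hg.lt_or_eq with hlt | heq
  · have bu : ∀ {D s a : ℝ}, |D| ≤ (2 * H) ^ 2 → |s| ≤ 2 * H → |a| ≤ H →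
        |-2 * (D * s * a ^ 2)| ≤ T := by
      intro D s a hD hs ha
      have := abs_mul_le_mul_of_abs_le (le_refl |(-2 : ℝ)|) (abs_mul_le_mul_of_abs_le
        (abs_mul_le_mul_of_abs_le hD hs) (abs_pow_le_pow_of_abs_le ha 2))
      refine this.trans ?_
      rw [abs_neg, abs_two, hT]
      have e : 2 * ((2 * (H : ℝ)) ^ 2 * (2 * H) * H ^ 2) = 16 * H ^ 5 := by ring
      linarith
    have bΓ : |(Γ : ℝ)| ≤ T := by
      have t : ∀ {a b c d : ℝ}, |a| ≤ H → |b| ≤ H → |c| ≤ H → |d| ≤ H →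
          |d ^ 2 * (2 * b ^ 3 - 9 * (a * b * c))| ≤ 11 * (H : ℝ) ^ 5 := by
        intro a b c d ha hb hc hd
        have h1 := abs_le.1 (abs_pow_le_pow_of_abs_le hb 3)
        have h2 := abs_le.1 (abs_mul_le_mul_of_abs_le (abs_mul_le_mul_of_abs_le ha hb) hc)
        have h3 : |2 * b ^ 3 - 9 * (a * b * c)| ≤ 11 * (H : ℝ) ^ 3 :=
          abs_le.2 ⟨by linarith, by linarith⟩
        exact (abs_mul_le_mul_of_abs_le (abs_pow_le_pow_of_abs_le hd 2) h3).trans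
          (le_of_eq (by ring))
      have h1 := abs_le.1 (t bA₁ bB₁ bC₁ bA₂)
      have h2 := abs_le.1 (t bA₂ bB₂ bC₂ bA₁)
      have h3 := abs_le.1 (abs_mul_le_mul_of_abs_le (abs_mul_le_mul_of_abs_le
        (abs_pow_le_pow_of_abs_le bA₁ 2) (abs_pow_le_pow_of_abs_le bA₂ 2)) bE)
      rw [hΓ]; push_cast
      exact abs_le.2 ⟨by linarith, by linarith⟩
    have hgs : S.cubic x y ≤ -(1 / (H : ℝ) ^ 47) := by
      apply hsep
      rw [hval]
      apply add_add_le_neg_of_sq_eq_int (U := 4 * D₁ ^ 3 * S.a₂ ^ 4) (V := 4 * D₂ ^ 3 * S.a₁ ^ 4)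
        _ _ hT1 (bu bD₁ bs₁' bA₂) (bu bD₂ bs₂' bA₁) bΓ
      · rw [← hval]; exact mul_neg_of_pos_of_neg (by linarith) hlt
      · push_cast; linear_combination (4 * (D₁ : ℝ) ^ 2 * S.a₂ ^ 4) * hsD₁
      · push_cast; linear_combination (4 * (D₂ : ℝ) ^ 2 * S.a₁ ^ 4) * hsD₂
    have hls : ∀ j, S.linear j x y < 0 → S.linear j x y ≤ -(1 / (H : ℝ) ^ 47) := by
      intro j hj
      have bα : |(S.α j : ℝ)| ≤ H := by exact_mod_cast hS.α j
      have bβ : |(S.β j : ℝ)| ≤ H := by exact_mod_cast hS.β j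
      have bγ : |(S.γ j : ℝ)| ≤ H := by exact_mod_cast hS.γ j
      set r : ℤ := 9 * (3 * (S.a₁ ^ 2 * S.a₂ ^ 2 * S.γ j) - S.a₁ * S.a₂ ^ 2 * S.α j * S.b₁
        - S.a₁ ^ 2 * S.a₂ * S.β j * S.b₂) with hr
      have hlval : 27 * ((S.a₁ : ℝ) ^ 2 * S.a₂ ^ 2) * S.linear j x y
          = 9 * (S.a₁ * S.a₂ ^ 2 * S.α j * s₁) + 9 * (S.a₁ ^ 2 * S.a₂ * S.β j * s₂) + r := by
        rw [hr]; unfold linear; rw [hx, hy]; push_cast; field_simp; ring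
      have t₁ : ∀ {s : ℝ} {X : ℝ}, |s| ≤ X → 
          |(S.a₁ : ℝ) * S.a₂ ^ 2 * S.α j * s| ≤ H ^ 4 * X := fun h =>
        (abs_mul_le_mul_of_abs_le (abs_mul_le_mul_of_abs_le (abs_mul_le_mul_of_abs_le bA₁
          (abs_pow_le_pow_of_abs_le bA₂ 2)) bα) h).trans (le_of_eq (by ring))
      have t₂ : ∀ {s : ℝ} {X : ℝ}, |s| ≤ X →
          |(S.a₁ : ℝ) ^ 2 * S.a₂ * S.β j * s| ≤ H ^ 4 * X := fun h =>
        (abs_mul_le_mul_of_abs_le (abs_mul_le_mul_of_abs_le (abs_mul_le_mul_of_abs_le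
          (abs_pow_le_pow_of_abs_le bA₁ 2) bA₂) bβ) h).trans (le_of_eq (by ring))
      have t₃ : |(S.a₁ : ℝ) ^ 2 * S.a₂ ^ 2 * S.γ j| ≤ H ^ 5 :=
        (abs_mul_le_mul_of_abs_le (abs_mul_le_mul_of_abs_le
          (abs_pow_le_pow_of_abs_le bA₁ 2) (abs_pow_le_pow_of_abs_le bA₂ 2)) bγ).trans
          (le_of_eq (by ring))
      have u₁ := abs_le.1 (t₁ bs₁')
      have u₂ := abs_le.1 (t₂ bs₂')
      have u₃ := abs_le.1 (t₁ bB₁)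
      have u₄ := abs_le.1 (t₂ bB₂)
      have u₅ := abs_le.1 t₃
      have e1 : (H : ℝ) ^ 4 * (2 * H) = 2 * H ^ 5 := by ring
      have e2 : (H : ℝ) ^ 4 * H = H ^ 5 := by ring
      rw [e1] at u₁ u₂
      rw [e2] at u₃ u₄
      apply hsep
      rw [hlval]
      apply add_add_le_neg_of_sq_eq_int
        (U := (9 * (S.a₁ * S.a₂ ^ 2 * S.α j)) ^ 2 * D₁)
        (V := (9 * (S.a₁ ^ 2 * S.a₂ * S.β j)) ^ 2 * D₂) _ _ hT1
      · exact abs_le.2 ⟨by linarith, by linarith⟩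
      · exact abs_le.2 ⟨by linarith, by linarith⟩
      · rw [hr]; push_cast; exact abs_le.2 ⟨by linarith, by linarith⟩
      · rw [← hlval]; exact mul_neg_of_pos_of_neg (by linarith) hj
      · push_cast; rw [← hsD₁]; ring
      · push_cast; rw [← hsD₂]; ring
    -- rounding to multiples of `1 / H ^ 49` changes the linear forms by at most `2 * H / H ^ 49`,
    -- which the slack `1 / H ^ 47` absorbs; the cubic changes only to second order
    set Δ : ℝ := (H : ℝ) ^ 49 with hΔ
    obtain ⟨h, hh, hxh⟩ := exists_small_heightLE hH hΔ (by linarith : 1 ≤ H) bx₁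
    obtain ⟨k, hk, hyk⟩ := exists_small_heightLE hH hΔ (by linarith : 1 ≤ H) bx₂
    have hΔ0 : 0 < Δ := by positivity
    have hΔ1 : 1 / Δ ≤ 1 := by
      rw [div_le_one hΔ0]; exact one_le_pow₀ (by linarith)
    have hroom : 2 * H * (1 / Δ) ≤ 1 / (H : ℝ) ^ 47 := by
      have : 1 / (H : ℝ) ^ 47 = H ^ 2 * (1 / Δ) := by rw [hΔ]; field_simp
      rw [this]
      rw [sq]
      exact mul_le_mul_of_nonneg_right (mul_le_mul_of_nonneg_right hH' (by linarith))
        (by positivity)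
    have hcub : ∀ {s a h : ℝ}, |s| ≤ 2 * H → |a| ≤ H → |h| ≤ 1 / Δ →
        s * h ^ 2 + a * h ^ 3 ≤ 3 * H * (1 / Δ) ^ 2 := by
      intro s a h hs ha hh
      have h1 := abs_mul_le_mul_of_abs_le hs (abs_pow_le_pow_of_abs_le hh 2)
      have h2 := abs_mul_le_mul_of_abs_le ha (abs_pow_le_pow_of_abs_le hh 3)
      have h3 : (H : ℝ) * (1 / Δ) ^ 3 ≤ H * (1 / Δ) ^ 2 :=
        mul_le_mul_of_nonneg_left (pow_le_pow_of_le_one (by positivity) hΔ1 (by norm_num))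
          (by linarith)
      linarith [le_abs_self (s * h ^ 2), le_abs_self (a * h ^ 3)]
    have hsq : 3 * H * (1 / Δ) ^ 2 * 2 ≤ 1 / (H : ℝ) ^ 47 := by
      have e : 1 / (H : ℝ) ^ 47 = H ^ 51 * (1 / Δ) ^ 2 := by rw [hΔ]; field_simp
      rw [e]
      have h6 : 6 * (H : ℝ) ^ 1 ≤ H ^ 4 := pow_mul_pow_le_of_two_le hH' (i := 3) (by norm_num)
      have h7 : (H : ℝ) ^ 4 ≤ H ^ 51 := pow_le_pow_right₀ (by linarith) (by norm_num)
      have : 0 ≤ (1 / Δ) ^ 2 := by positivity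
      have := mul_le_mul_of_nonneg_right (h6.trans h7) this
      linarith
    refine ⟨x + h, y + k, ⟨?_, ?_⟩, ?_, ?_⟩
    · have e₁ := cubic_add_at_critical (h := h) hA₁ hD₁ hx
      have e₂ := cubic_add_at_critical (h := k) hA₂ hD₂ hy
      have g₁ := hcub bs₁' bA₁ hh
      have g₂ := hcub bs₂' bA₂ hk
      unfold cubic at hgs ⊢
      rw [e₁, e₂]
      linarith
    · intro j
      rcases hstrict j with hj | ⟨hα, hβ⟩
      · have := hls j hj
        have bα : |(S.α j : ℝ)| ≤ H := by exact_mod_cast hS.α j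
        have bβ : |(S.β j : ℝ)| ≤ H := by exact_mod_cast hS.β j
        have h1 := le_trans (le_abs_self _) (abs_mul_le_mul_of_abs_le bα hh)
        have h2 := le_trans (le_abs_self _) (abs_mul_le_mul_of_abs_le bβ hk)
        unfold linear at this ⊢
        linarith
      · have := hl j
        unfold linear at this ⊢
        simpa [hα, hβ] using this
    · exact hxh.mono (by rw [← pow_succ'])
    · exact hyk.mono (by rw [← pow_succ'])
  · have hsum : 2 * (D₁ * s₁ * S.a₂ ^ 2) + 2 * (D₂ * s₂ * S.a₁ ^ 2) = Γ := by
      rw [heq, mul_zero] at hval; linarith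
    have hint : ∀ {s t : ℝ} {D D' a b G : ℤ}, 0 ≤ s → 0 ≤ t → a ≠ 0 → s ^ 2 = D → t ^ 2 = D' →
        2 * (D * s * a ^ 2) + 2 * (D' * t * b ^ 2) = (G : ℝ) → ∃ z : ℤ, s = z := by
      intro s t D D' a b G hs ht ha hD hD' h
      rcases hs.eq_or_lt with h0 | h0
      · exact ⟨0, by simp [← h0]⟩
      have hDpos : 0 < D := by
        have : (0 : ℝ) < D := by rw [← hD]; positivity
        exact_mod_cast this
      have hDpos' : 0 ≤ D' := by
        have : (0 : ℝ) ≤ D' := by rw [← hD']; positivity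
        exact_mod_cast this
      exact exists_int_eq_of_mul_add_mul_eq (p := 2 * D * a ^ 2) (q := 2 * D' * b ^ 2) (r := G)
        h0 ht hD hD' (by positivity) (by positivity) (by push_cast; linarith)
    obtain ⟨z₁, hz₁⟩ := hint hs₁ hs₂ ha₂ hsD₁ hsD₂ hsum
    obtain ⟨z₂, hz₂⟩ := hint hs₂ hs₁ ha₁ hsD₂ hsD₁ (by rw [add_comm]; exact hsum)
    have hsmall : 3 * H ≤ H ^ 51 := by
      have h6 : 3 * (H : ℝ) ^ 1 ≤ H ^ 3 := pow_mul_pow_le_of_two_le hH' (i := 2) (by norm_num)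
      have h7 : (H : ℝ) ^ 3 ≤ H ^ 51 := pow_le_pow_right₀ (by linarith) (by norm_num)
      have := h6.trans h7
      rw [pow_one] at this
      exact_mod_cast this
    have hht : ∀ {z a b : ℤ} {w : ℝ}, a ≠ 0 → |(z : ℝ)| ≤ 2 * H → |b| ≤ H → |a| ≤ H →
        w = (z - b) / (3 * a) → HeightLE (H ^ 51) w := by
      intro z a b w ha hz hb ha' hw
      have hz' : |z| ≤ 2 * H := by exact_mod_cast hz
      rw [abs_le] at hz' hb
      have h1 : |z - b| ≤ 3 * H := abs_le.2 ⟨by linarith, by linarith⟩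
      refine HeightLE.of_div (N := z - b) (D := 3 * a) (by omega) (h1.trans hsmall) ?_
        (by rw [hw]; push_cast; ring)
      rw [abs_mul, show |(3 : ℤ)| = 3 from rfl]; linarith
    exact ⟨x, y, ⟨hg, hl⟩, hht ha₁ (hz₁ ▸ bs₁') hS.b₁ hS.a₁ (hz₁ ▸ hx),
      hht ha₂ (hz₂ ▸ bs₂') hS.b₂ hS.a₂ (hz₂ ▸ hy)⟩

end CubicSystem

/-! ### Univariate systems -/

open Filter Topology in
/-- A cubic attains its minimum over the part of `[-M, M]` cut out by linear constraints either at a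
proper endpoint, or at `±M`, or at a nondegenerate local minimum, unless it is constant. -/
theorem exists_cubic_minimizer {m : ℕ} (a b c : ℝ) (α δ : Fin m → ℝ) {M t₀ : ℝ} (ht₀ : |t₀| ≤ M)
    (hI : ∀ j, α j * t₀ + δ j ≤ 0) :
    ∃ t, |t| ≤ M ∧ (∀ j, α j * t + δ j ≤ 0) ∧
      a * t ^ 3 + b * t ^ 2 + c * t ≤ a * t₀ ^ 3 + b * t₀ ^ 2 + c * t₀ ∧
      ((∃ j, α j ≠ 0 ∧ α j * t + δ j = 0) ∨ |t| = M ∨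
        (3 * a * t ^ 2 + 2 * b * t + c = 0 ∧ 0 < 3 * a * t + b) ∨ (a = 0 ∧ b = 0 ∧ c = 0)) := by
  set φ : ℝ → ℝ := fun t => a * t ^ 3 + b * t ^ 2 + c * t with hφ
  set K : Set ℝ := Set.Icc (-M) M ∩ {t | ∀ j, α j * t + δ j ≤ 0} with hK
  have hKc : IsCompact K := by
    apply isCompact_Icc.inter_right
    have : {t : ℝ | ∀ j, α j * t + δ j ≤ 0} = ⋂ j, {t : ℝ | α j * t + δ j ≤ 0} := by
      ext t; simp
    rw [this]
    exact isClosed_iInter fun j => isClosed_le (by fun_prop) continuous_const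
  obtain ⟨t, ⟨htM, htI⟩, hmin⟩ := hKc.exists_isMinOn (f := φ) ⟨t₀, abs_le.1 ht₀, hI⟩
    (by fun_prop)
  refine ⟨t, abs_le.2 htM, htI, hmin ⟨abs_le.1 ht₀, hI⟩, ?_⟩
  by_cases h1 : ∃ j, α j ≠ 0 ∧ α j * t + δ j = 0
  · exact Or.inl h1
  by_cases h2 : |t| = M
  · exact Or.inr (Or.inl h2)
  right; right
  push Not at h1
  have hKt : ∀ᶠ u in 𝓝 t, u ∈ K := by
    have e1 : ∀ᶠ u in 𝓝 t, |u| < M :=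
      (continuous_abs.tendsto t).eventually_lt_const (lt_of_le_of_ne (abs_le.2 htM) h2)
    have e2 : ∀ᶠ u in 𝓝 t, ∀ j, α j * u + δ j ≤ 0 := by
      rw [eventually_all]
      intro j
      by_cases hj : α j = 0
      · have := htI j
        exact Eventually.of_forall fun u => by simpa [hj] using this
      · have hc : Continuous fun u : ℝ => α j * u + δ j := by fun_prop
        exact ((hc.tendsto t).eventually_lt_const
          (lt_of_le_of_ne (htI j) (h1 j hj))).mono fun u hu => hu.le
    filter_upwards [e1, e2] with u h3 h4
    exact ⟨abs_le.1 h3.le, h4⟩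
  have hloc : ∀ᶠ u in 𝓝 t, φ t ≤ φ u := hKt.mono fun u hu => hmin hu
  have hd : HasDerivAt φ (3 * a * t ^ 2 + 2 * b * t + c) t := by
    have h := (((hasDerivAt_pow 3 t).const_mul a).add ((hasDerivAt_pow 2 t).const_mul b)).add
      ((hasDerivAt_id t).const_mul c)
    exact h.congr_deriv (by push_cast; ring)
  have hcrit : 3 * a * t ^ 2 + 2 * b * t + c = 0 := IsLocalMin.hasDerivAt_eq_zero hloc hd
  obtain ⟨ε, hε, hball⟩ := Metric.eventually_nhds_iff.1 hloc
  -- `φ (t + h) - φ t = h ^ 2 * ((3 * a * t + b) + a * h)`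
  have key : ∀ h : ℝ, h ≠ 0 → |h| < ε → 0 ≤ 3 * a * t + b + a * h := by
    intro h h0 hh
    have h5 := hball (y := t + h) (by rw [Real.dist_eq]; simpa using hh)
    have h6 : 0 ≤ h ^ 2 * (3 * a * t + b + a * h) := by
      simp only [hφ] at h5
      linear_combination h5 + h * hcrit
    exact nonneg_of_mul_nonneg_right h6 (by positivity)
  have k1 := key (ε / 2) (by positivity) (by rw [abs_of_pos] <;> linarith)
  have k2 := key (-(ε / 2)) (by simpa using hε.ne') (by rw [abs_neg, abs_of_pos] <;> linarith)
  rcases lt_or_ge 0 (3 * a * t + b) with h7 | h7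
  · exact Or.inl ⟨hcrit, h7⟩
  · right
    have ha : a = 0 := by
      have h8 : a * (ε / 2) = 0 := by linarith
      rcases mul_eq_zero.1 h8 with h | h <;> linarith
    subst ha
    have hb : b = 0 := by linarith
    subst hb
    exact ⟨rfl, rfl, by linarith⟩

/-- Beyond `3 * H`, the sign of a cubic with integer coefficients bounded by `H` is constant. -/
theorem cubic_nonpos_of_le {a b c e H : ℤ} {t M : ℝ} (hb : |b| ≤ H) (hc : |c| ≤ H)
    (he : |e| ≤ H) (hH : 1 ≤ H) (hM : 3 * (H : ℝ) ≤ M) (htM : M ≤ t)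
    (h : a * t ^ 3 + b * t ^ 2 + c * t + e ≤ 0) : a * M ^ 3 + b * M ^ 2 + c * M + e ≤ 0 := by
  have hH' : (1 : ℝ) ≤ H := by exact_mod_cast hH
  have bb := abs_le.1 (show |(b : ℝ)| ≤ H by exact_mod_cast hb)
  have bc := abs_le.1 (show |(c : ℝ)| ≤ H by exact_mod_cast hc)
  have be := abs_le.1 (show |(e : ℝ)| ≤ H by exact_mod_cast he)
  -- the lower order terms are smaller than the leading one
  have low : ∀ {u : ℝ}, M ≤ u → ∀ {k : ℝ}, |k| ≤ H → |k * u ^ 2| ≤ H * u ^ 2 := by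
    intro u hu k hk
    exact abs_mul_le_mul_of_abs_le hk (by rw [abs_of_nonneg (by positivity)])
  have l1 : ∀ {u : ℝ}, M ≤ u → ∀ {k : ℝ}, -H ≤ k ∧ k ≤ H → -(H * u) ≤ k * u ∧ k * u ≤ H * u := by
    intro u hu k hk
    constructor <;> nlinarith
  have pows : ∀ {u : ℝ}, M ≤ u → H < u ^ 1 ∧ H * u + H < u ^ 2 ∧ H * u ^ 2 + H * u + H < u ^ 3 := by
    intro u hu
    have hu1 : 1 ≤ u := by linarith
    have h2 : 3 * H * u ≤ u ^ 2 := by nlinarith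
    have h3 : 3 * H * u ^ 2 ≤ u ^ 3 := by nlinarith [sq_nonneg u]
    have h4 : u ≤ u ^ 2 := by nlinarith
    refine ⟨by linarith, by nlinarith, ?_⟩
    nlinarith
  have q2 : ∀ {u : ℝ}, M ≤ u → -(H * u ^ 2) ≤ b * u ^ 2 ∧ b * u ^ 2 ≤ H * u ^ 2 := fun {u} hu =>
    abs_le.1 (low hu (abs_le.2 bb))
  have int_cases : ∀ k : ℤ, k ≠ 0 → (1 : ℝ) ≤ k ∨ (k : ℝ) ≤ -1 := by
    intro k hk
    rcases lt_or_gt_of_ne hk with h | h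
    · right; exact_mod_cast (by omega : k ≤ -1)
    · left; exact_mod_cast h
  have hMM := le_refl M
  by_cases ha0 : a = 0
  · subst ha0
    by_cases hb0 : b = 0
    · subst hb0
      by_cases hc0 : c = 0
      · subst hc0; simpa using h
      · rcases int_cases c hc0 with h1 | h1
        · have := pows htM
          have : t ≤ c * t := by nlinarith
          simp at h; linarith
        · have := pows hMM
          have : c * M ≤ -M := by nlinarith
          simp; linarith
    · rcases int_cases b hb0 with h1 | h1
      · have := pows htM
        have := l1 htM bc
        have : t ^ 2 ≤ b * t ^ 2 := by nlinarith [sq_nonneg t]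
        simp at h; linarith
      · have := pows hMM
        have := l1 hMM bc
        have : b * M ^ 2 ≤ -M ^ 2 := by nlinarith [sq_nonneg M]
        simp; linarith
  · rcases int_cases a ha0 with h1 | h1
    · have := pows htM
      have := l1 htM bc
      have := q2 htM
      have h3 : 0 ≤ t ^ 3 := pow_nonneg (by linarith) 3
      have : t ^ 3 ≤ a * t ^ 3 := by nlinarith
      linarith
    · have := pows hMM
      have := l1 hMM bc
      have := q2 hMM
      have h3 : 0 ≤ M ^ 3 := pow_nonneg (by linarith) 3
      have : a * M ^ 3 ≤ -M ^ 3 := by nlinarith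
      linarith

/-- A linear constraint satisfied beyond the range of its zero also holds at the boundary of that
range. -/
theorem linear_nonpos_of_le {α γ H : ℤ} {t M : ℝ} (hγ : |γ| ≤ H) (hHM : (H : ℝ) < M)
    (htM : M ≤ t) (h : α * t + γ ≤ 0) : α * M + γ ≤ 0 := by
  have bγ := abs_le.1 (show |(γ : ℝ)| ≤ H by exact_mod_cast hγ)
  rcases lt_trichotomy α 0 with h1 | h1 | h1
  · have : (α : ℝ) ≤ -1 := by exact_mod_cast (by omega : α ≤ -1)
    nlinarith
  · subst h1; simpa using h
  · have : (1 : ℝ) ≤ α := by exact_mod_cast h1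
    nlinarith

/-- A solvable univariate system, consisting of an inequality of degree at most three and linear
inequalities, has a small rational solution. -/
theorem exists_small_solution_of_univariate {m : ℕ} {a b c e H : ℤ} {α γ : Fin m → ℤ} (hH : 2 ≤ H)
    (ha : |a| ≤ H) (hb : |b| ≤ H) (hc : |c| ≤ H) (he : |e| ≤ H) (hα : ∀ j, |α j| ≤ H)
    (hγ : ∀ j, |γ j| ≤ H) {t₀ : ℝ} (h₀ : a * t₀ ^ 3 + b * t₀ ^ 2 + c * t₀ + e ≤ 0)
    (hl₀ : ∀ j, α j * t₀ + γ j ≤ 0) :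
    ∃ t : ℝ, a * t ^ 3 + b * t ^ 2 + c * t + e ≤ 0 ∧ (∀ j, α j * t + γ j ≤ 0) ∧
      HeightLE (H ^ 51) t := by
  have hH' : (2 : ℝ) ≤ H := by exact_mod_cast hH
  set M : ℤ := H ^ 3 with hM
  have hM3 : 3 * H ≤ M := by
    have : 4 ≤ H ^ 2 := by nlinarith
    rw [hM]; nlinarith
  have hM3' : 3 * (H : ℝ) ≤ M := by exact_mod_cast hM3
  have hM51 : H ^ 3 ≤ H ^ 51 := pow_le_pow_right₀ (by linarith) (by norm_num)
  have h1_51 : H ≤ H ^ 51 := by linarith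
  have habsM : ∀ {t : ℝ}, |t| = M → HeightLE (H ^ 51) t := by
    intro t ht
    have hMM : |M| ≤ H ^ 51 := by rw [abs_of_pos (by linarith)]; linarith
    rcases (abs_eq (by exact_mod_cast (by linarith : (0 : ℤ) ≤ M))).1 ht with h | h
    · rw [h]; exact HeightLE.intCast hMM (by linarith)
    · rw [h]; exact (HeightLE.intCast hMM (by linarith)).neg
  have htight : ∀ {t : ℝ}, (∃ j, (α j : ℝ) ≠ 0 ∧ α j * t + (γ j : ℝ) = 0) →
      HeightLE (H ^ 51) t := by
    rintro t ⟨j, h1, h2⟩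
    refine HeightLE.of_div (N := -γ j) (D := α j) (by exact_mod_cast h1) ?_ ((hα j).trans h1_51) ?_
    · rw [abs_neg]; exact (hγ j).trans h1_51
    · rw [eq_div_iff h1]; push_cast; linarith
  rcases le_or_gt (M : ℝ) |t₀| with hbig | hsmall
  · rcases le_or_gt 0 t₀ with hpos | hneg
    · rw [abs_of_nonneg hpos] at hbig
      refine ⟨M, cubic_nonpos_of_le hb hc he (by linarith) hM3' hbig h₀,
        fun j => linear_nonpos_of_le (hγ j) (by linarith) hbig (hl₀ j), habsM ?_⟩
      rw [abs_of_pos]; linarith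
    · rw [abs_of_neg hneg] at hbig
      refine ⟨-M, ?_, fun j => ?_, habsM ?_⟩
      · have := cubic_nonpos_of_le (a := -a) (b := b) (c := -c) (e := e) hb (by rwa [abs_neg]) he
          (by linarith) hM3' hbig (by push_cast; linear_combination h₀)
        push_cast at this; linear_combination this
      · have := linear_nonpos_of_le (α := -α j) (hγ j) (by linarith) hbig
          (by push_cast; linear_combination hl₀ j)
        push_cast at this; linear_combination this
      · rw [abs_neg, abs_of_pos]; linarith
  · obtain ⟨t, htM, htI, hle, hcase⟩ := exists_cubic_minimizer (a : ℝ) b c (fun j => (α j : ℝ))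
      (fun j => (γ j : ℝ)) hsmall.le hl₀
    have hφ : a * t ^ 3 + b * t ^ 2 + c * t + e ≤ 0 := by linarith
    rcases hcase with h | h | ⟨hcrit, hpos⟩ | ⟨ha0, hb0, hc0⟩
    · exact ⟨t, hφ, htI, htight h⟩
    · exact ⟨t, hφ, htI, habsM h⟩
    · by_cases h1 : ∃ j, (α j : ℝ) ≠ 0 ∧ α j * t + (γ j : ℝ) = 0
      · exact ⟨t, hφ, htI, htight h1⟩
      push Not at h1
      by_cases ha0 : a = 0
      · subst ha0
        simp only [Int.cast_zero, mul_zero, zero_mul, zero_add] at hcrit hpos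
        refine ⟨t, hφ, htI, HeightLE.of_div (N := -c) (D := 2 * b) ?_ ?_ ?_ ?_⟩
        · have : 0 < b := by exact_mod_cast hpos
          omega
        · rw [abs_neg]; linarith
        · rw [abs_mul, abs_two]; linarith
        · push_cast; rw [eq_div_iff (by positivity)]; linarith
      · -- embed into the plane by adding `y³ + y²`, which is nonnegative where `-y - 1 ≤ 0` and
        -- has a local minimum of value `0` at `y = 0`
        let S : CubicSystem (m + 1) :=
          ⟨a, b, c, 1, 1, 0, e, Fin.cons 0 α, Fin.cons (-1) 0, Fin.cons (-1) γ⟩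
        have hz : |(0 : ℤ)| ≤ H := by rw [abs_zero]; linarith
        have h1' : |(1 : ℤ)| ≤ H := by rw [abs_one]; linarith
        have h1'' : |(-1 : ℤ)| ≤ H := by rw [abs_neg]; exact h1'
        have hS : S.BoundedBy H :=
          ⟨ha, hb, hc, h1', h1', hz, he, Fin.cases hz hα, Fin.cases h1'' fun _ => hz,
            Fin.cases h1'' hγ⟩
        have ha0' : (a : ℝ) ≠ 0 := by exact_mod_cast ha0
        obtain ⟨x, y, ⟨h2, h3⟩, h4, -⟩ := CubicSystem.hasSmallSolution_of_critical hH hS ha0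
          one_ne_zero hpos.le zero_le_one (s₁ := 3 * a * t + b) (s₂ := 1) (x := t) (y := 0)
          (by simp only [S]; linear_combination (3 * (a : ℝ)) * hcrit) (by simp [S])
          (by simp only [S]; field_simp; ring) (by simp [S])
          ⟨by simpa [S, CubicSystem.cubic] using hφ,
            Fin.cases (by simp [S, CubicSystem.linear])
              fun j => by simpa [S, CubicSystem.linear] using htI j⟩
          (Fin.cases (Or.inl (by simp [S, CubicSystem.linear])) fun j => by
            by_cases hj : α j = 0
            · exact Or.inr ⟨hj, rfl⟩
            · exact Or.inl (by
                simpa [S, CubicSystem.linear] using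
                  lt_of_le_of_ne (htI j) (h1 j (by exact_mod_cast hj))))
        refine ⟨x, ?_, fun j => by simpa [S, CubicSystem.linear] using h3 j.succ, h4⟩
        have hy := h3 0
        simp only [S, CubicSystem.linear, CubicSystem.cubic, Fin.cons_zero] at h2 hy
        push_cast at h2 hy
        have : 0 ≤ y ^ 2 * (y + 1) := mul_nonneg (sq_nonneg y) (by linarith)
        linarith
    · -- the cubic is constant; minimize the coordinate instead
      obtain ⟨u, huM, huI, -, hcase⟩ := exists_cubic_minimizer (0 : ℝ) 0 1 (fun j => (α j : ℝ))
        (fun j => (γ j : ℝ)) hsmall.le hl₀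
      have hφ' : a * u ^ 3 + b * u ^ 2 + c * u + e ≤ 0 := by
        rw [ha0, hb0, hc0] at hφ ⊢; linarith
      rcases hcase with h | h | ⟨h, -⟩ | ⟨-, -, h⟩
      · exact ⟨u, hφ', huI, htight h⟩
      · exact ⟨u, hφ', huI, habsM h⟩
      · norm_num at h
      · norm_num at h

/-! ### Small solutions of planar systems -/

namespace CubicSystem

variable {m : ℕ}

/-- Exchange of the two variables. -/
def swap (S : CubicSystem m) : CubicSystem m :=
  ⟨S.a₂, S.b₂, S.c₂, S.a₁, S.b₁, S.c₁, S.e, S.β, S.α, S.γ⟩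

/-- The substitution `x ↦ -x`. -/
def reflect (S : CubicSystem m) : CubicSystem m :=
  ⟨-S.a₁, S.b₁, -S.c₁, S.a₂, S.b₂, S.c₂, S.e, -S.α, S.β, S.γ⟩

theorem BoundedBy.swap {S : CubicSystem m} {H : ℤ} (h : S.BoundedBy H) : S.swap.BoundedBy H :=
  ⟨h.a₂, h.b₂, h.c₂, h.a₁, h.b₁, h.c₁, h.e, h.β, h.α, h.γ⟩

theorem BoundedBy.reflect {S : CubicSystem m} {H : ℤ} (h : S.BoundedBy H) :
    S.reflect.BoundedBy H :=
  ⟨(abs_neg _).trans_le h.a₁, h.b₁, (abs_neg _).trans_le h.c₁, h.a₂, h.b₂, h.c₂, h.e,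
    fun j => (abs_neg _).trans_le (h.α j), h.β, h.γ⟩

theorem Feasible.swap {S : CubicSystem m} {x y : ℝ} (h : S.Feasible x y) : S.swap.Feasible y x := by
  refine ⟨?_, fun j => ?_⟩
  · have := h.1
    simp only [CubicSystem.swap, cubic] at this ⊢; linarith
  · have := h.2 j
    simp only [CubicSystem.swap, linear] at this ⊢; linarith

theorem Feasible.reflect {S : CubicSystem m} {x y : ℝ} (h : S.Feasible x y) :
    S.reflect.Feasible (-x) y := by
  refine ⟨?_, fun j => ?_⟩
  · have := h.1
    simp only [CubicSystem.reflect, cubic] at this ⊢; push_cast; linear_combination this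
  · have := h.2 j
    simp only [CubicSystem.reflect, linear, Pi.neg_apply] at this ⊢; push_cast
    linear_combination this

theorem reflect_reflect (S : CubicSystem m) : S.reflect.reflect = S := by
  simp [CubicSystem.reflect]

theorem HasSmallSolution.of_swap {S : CubicSystem m} {B : ℤ} (h : S.swap.HasSmallSolution B) :
    S.HasSmallSolution B := by
  obtain ⟨x, y, h1, h2, h3⟩ := h
  exact ⟨y, x, h1.swap, h3, h2⟩

theorem HasSmallSolution.of_reflect {S : CubicSystem m} {B : ℤ}
    (h : S.reflect.HasSmallSolution B) : S.HasSmallSolution B := by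
  obtain ⟨x, y, h1, h2, h3⟩ := h
  exact ⟨-x, y, S.reflect_reflect ▸ h1.reflect, h2.neg, h3⟩

/-- A feasible point on a nonvertical constraint line `αx + βy + γ = 0` gives a small rational
solution: eliminating `y` and multiplying by even powers of `β` leaves a univariate system. -/
theorem hasSmallSolution_of_linear_eq_zero {S : CubicSystem m} {H : ℤ} (hH : 2 ≤ H)
    (hS : S.BoundedBy H) {x y : ℝ} (hf : S.Feasible x y) {j : Fin m} (hj : S.linear j x y = 0)
    (hβ : S.β j ≠ 0) : S.HasSmallSolution (H ^ 410) := by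
  have hH' : (2 : ℝ) ≤ H := by exact_mod_cast hH
  obtain ⟨ha₁, hb₁, hc₁, ha₂, hb₂, hc₂, he, hα, hβ', hγ⟩ := hS
  obtain ⟨hg, hl⟩ := hf
  set p := S.α j with hp
  set q := S.β j with hq
  set r := S.γ j with hr
  have hq0 : (q : ℝ) ≠ 0 := by exact_mod_cast hβ
  have bp : |p| ≤ H := hα j
  have bq : |q| ≤ H := hβ' j
  have br : |r| ≤ H := hγ j
  have line : ∀ {u v : ℝ}, v = -(p * u + r) / q → q * v = -(p * u + r) := fun h => by
    rw [h]; field_simp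
  have hy : y = -(p * x + r) / q := by
    rw [eq_div_iff hq0]; unfold linear at hj; linarith
  -- `β ^ 4` times the cubic and `β ^ 2` times the linear forms, restricted to the line;
  -- their coefficients are at most `H ^ 8`, so the univariate bound is `(H ^ 8) ^ 51 = H ^ 408`
  set A : ℤ := q ^ 4 * S.a₁ - q * S.a₂ * p ^ 3 with hA
  set B : ℤ := q ^ 4 * S.b₁ - 3 * (q * S.a₂ * (p ^ 2 * r)) + q ^ 2 * S.b₂ * p ^ 2 with hB
  set C : ℤ := q ^ 4 * S.c₁ - 3 * (q * S.a₂ * (p * r ^ 2)) + 2 * (q ^ 2 * S.b₂ * (p * r))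
    - q ^ 3 * S.c₂ * p with hC
  set E : ℤ := q ^ 4 * S.e - q * S.a₂ * r ^ 3 + q ^ 2 * S.b₂ * r ^ 2 - q ^ 3 * S.c₂ * r with hE
  have hcubic : ∀ {u v : ℝ}, v = -(p * u + r) / q →
      A * u ^ 3 + B * u ^ 2 + C * u + E = q ^ 4 * S.cubic u v := by
    intro u v h
    rw [h, hA, hB, hC, hE]; unfold cubic; push_cast; field_simp; ring
  have hlin : ∀ {u v : ℝ} (k : Fin m), v = -(p * u + r) / q →
      ((q ^ 2 * S.α k - q * S.β k * p : ℤ) : ℝ) * u + ((q ^ 2 * S.γ k - q * S.β k * r : ℤ) : ℝ)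
        = q ^ 2 * S.linear k u v := by
    intro u v k h
    rw [h]; unfold linear; push_cast; field_simp; ring
  have hq4 : (0 : ℝ) < q ^ 4 := by positivity
  have hq2 : (0 : ℝ) < q ^ 2 := by positivity
  have hpow : ∀ i j : ℕ, i ≤ j → H ^ i ≤ H ^ j := fun i j h => pow_le_pow_right₀ (by linarith) h
  have h58 : 8 * H ^ 5 ≤ H ^ 8 := by
    have := pow_mul_pow_le_of_two_le hH' (c := 8) (i := 3) (j := 5) (by norm_num)
    exact_mod_cast this
  have h45 := hpow 4 5 (by norm_num)
  have h35 := hpow 3 5 (by norm_num)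
  have h05 : 0 < H ^ 5 := by positivity
  have hH8 : 2 ≤ H ^ 8 := by have := hpow 1 8 (by norm_num); linarith
  have t1 : ∀ {k : ℤ}, |k| ≤ H → |q ^ 4 * k| ≤ H ^ 5 := fun h =>
    (abs_mul_le_mul_of_abs_le (abs_pow_le_pow_of_abs_le bq 4) h).trans_eq (by ring)
  have t2 : ∀ {w : ℤ}, |w| ≤ H ^ 3 → |q * S.a₂ * w| ≤ H ^ 5 := fun h =>
    (abs_mul_le_mul_of_abs_le (abs_mul_le_mul_of_abs_le bq ha₂) h).trans_eq (by ring)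
  have t3 : ∀ {w : ℤ}, |w| ≤ H ^ 2 → |q ^ 2 * S.b₂ * w| ≤ H ^ 5 := fun h =>
    (abs_mul_le_mul_of_abs_le (abs_mul_le_mul_of_abs_le (abs_pow_le_pow_of_abs_le bq 2) hb₂)
      h).trans_eq (by ring)
  have t4 : ∀ {w : ℤ}, |w| ≤ H → |q ^ 3 * S.c₂ * w| ≤ H ^ 5 := fun h =>
    (abs_mul_le_mul_of_abs_le (abs_mul_le_mul_of_abs_le (abs_pow_le_pow_of_abs_le bq 3) hc₂)
      h).trans_eq (by ring)
  have t5 : ∀ {k k' w : ℤ}, |k| ≤ H → |k'| ≤ H → |w| ≤ H →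
      |q ^ 2 * k - q * k' * w| ≤ H ^ 8 := by
    intro k k' w h1 h2 h3
    have h4 := abs_le.1 (abs_mul_le_mul_of_abs_le (abs_pow_le_pow_of_abs_le bq 2) h1)
    have h5 := abs_le.1 (abs_mul_le_mul_of_abs_le (abs_mul_le_mul_of_abs_le bq h2) h3)
    exact abs_le.2 ⟨by linarith, by linarith⟩
  have bprod : ∀ {u v : ℤ}, |u| ≤ H → |v| ≤ H → |u * v| ≤ H ^ 2 := fun h1 h2 =>
    (abs_mul_le_mul_of_abs_le h1 h2).trans_eq (by ring)
  have bp2 := abs_pow_le_pow_of_abs_le bp 2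
  have br2 := abs_pow_le_pow_of_abs_le br 2
  have bA : |A| ≤ H ^ 8 := by
    have h1 := abs_le.1 (t1 ha₁)
    have h2 := abs_le.1 (t2 (abs_pow_le_pow_of_abs_le bp 3))
    exact abs_le.2 ⟨by linarith, by linarith⟩
  have bB : |B| ≤ H ^ 8 := by
    have h1 := abs_le.1 (t1 hb₁)
    have h2 := abs_le.1 (t2 (w := p ^ 2 * r)
      ((abs_mul_le_mul_of_abs_le bp2 br).trans_eq (by ring)))
    have h3 := abs_le.1 (t3 bp2)
    exact abs_le.2 ⟨by linarith, by linarith⟩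
  have bC : |C| ≤ H ^ 8 := by
    have h1 := abs_le.1 (t1 hc₁)
    have h2 := abs_le.1 (t2 (w := p * r ^ 2)
      ((abs_mul_le_mul_of_abs_le bp br2).trans_eq (by ring)))
    have h3 := abs_le.1 (t3 (bprod bp br))
    have h4 := abs_le.1 (t4 bp)
    exact abs_le.2 ⟨by linarith, by linarith⟩
  have bE : |E| ≤ H ^ 8 := by
    have h1 := abs_le.1 (t1 he)
    have h2 := abs_le.1 (t2 (abs_pow_le_pow_of_abs_le br 3))
    have h3 := abs_le.1 (t3 br2)
    have h4 := abs_le.1 (t4 br)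
    exact abs_le.2 ⟨by linarith, by linarith⟩
  obtain ⟨u, hu, hul, N, D, hD, hN, hDH, huND⟩ := exists_small_solution_of_univariate hH8 bA bB bC
    bE (fun k => t5 (hα k) (hβ' k) bp) (fun k => t5 (hγ k) (hβ' k) br) (t₀ := x)
    (by rw [hcubic hy]; exact mul_nonpos_of_nonneg_of_nonpos hq4.le hg)
    (fun k => by rw [hlin k hy]; exact mul_nonpos_of_nonneg_of_nonpos hq2.le (hl k))
  rw [← pow_mul] at hN hDH
  norm_num at hN hDH
  have hbig : 2 * (H * H ^ 408) ≤ H ^ 410 := by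
    have h0 : 0 < H ^ 408 := by positivity
    calc 2 * (H * H ^ 408) ≤ H * (H * H ^ 408) := mul_le_mul_of_nonneg_right hH (by positivity)
      _ = _ := by ring
  have h410 := hpow 408 410 (by norm_num)
  refine ⟨u, -(p * u + r) / q, ⟨?_, fun k => ?_⟩, ⟨N, D, hD, hN.trans h410, hDH.trans h410, huND⟩,
    HeightLE.of_div (N := -(p * N + r * D)) (D := q * D) (mul_ne_zero hβ hD.ne') ?_ ?_ ?_⟩
  · rw [hcubic rfl] at hu
    exact nonpos_of_mul_nonpos_right hu hq4
  · have := hul k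
    rw [hlin k rfl] at this
    exact nonpos_of_mul_nonpos_right this hq2
  · have hDa : |D| ≤ H ^ 408 := by rwa [abs_of_pos hD]
    have h1 := abs_le.1 (abs_mul_le_mul_of_abs_le bp hN)
    have h2 := abs_le.1 (abs_mul_le_mul_of_abs_le br hDa)
    exact abs_le.2 ⟨by linarith, by linarith⟩
  · have hDa : |D| ≤ H ^ 408 := by rwa [abs_of_pos hD]
    have h1 := abs_mul_le_mul_of_abs_le bq hDa
    have : 0 ≤ H * H ^ 408 := by positivity
    linarith
  · have hD' : (D : ℝ) ≠ 0 := by exact_mod_cast hD.ne'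
    rw [huND]; push_cast; field_simp

/-- If no constraint bounds `y` from below, `y` can be decreased until the cubic is negative. -/
theorem hasSmallSolution_of_unbounded {S : CubicSystem m} {H : ℤ} (hH : 2 ≤ H)
    (hS : S.BoundedBy H) (ha₂ : 0 < S.a₂) {x y : ℝ} (hf : S.Feasible x y)
    (hβ : ∀ j, 0 ≤ S.β j) : S.HasSmallSolution (H ^ 410) := by
  have hH' : (2 : ℝ) ≤ H := by exact_mod_cast hH
  have hz : |(0 : ℤ)| ≤ H := by rw [abs_zero]; linarith
  have bz : ∀ {f : Fin m → ℤ}, (∀ j, |f j| ≤ H) → ∀ j, |if S.β j = 0 then f j else 0| ≤ H := by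
    intro f hf j
    split_ifs
    · exact hf j
    · exact hz
  -- only the constraints without `y` restrict `x`
  obtain ⟨u, -, hul, huH⟩ := exists_small_solution_of_univariate (a := 0) (b := 0) (c := 0)
    (e := 0) hH hz hz hz hz (bz hS.α) (bz hS.γ) (t₀ := x) (by simp) (by
      intro j
      split_ifs with h
      · have := hf.2 j
        simpa [linear, h] using this
      · simp)
  have hu := huH.abs_le
  push_cast at hu
  have bA₁ : |(S.a₁ : ℝ)| ≤ H := by exact_mod_cast hS.a₁
  have bB₁ : |(S.b₁ : ℝ)| ≤ H := by exact_mod_cast hS.b₁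
  have bC₁ : |(S.c₁ : ℝ)| ≤ H := by exact_mod_cast hS.c₁
  have bB₂ := abs_le.1 (show |(S.b₂ : ℝ)| ≤ H by exact_mod_cast hS.b₂)
  have bC₂ := abs_le.1 (show |(S.c₂ : ℝ)| ≤ H by exact_mod_cast hS.c₂)
  have bE := abs_le.1 (show |(S.e : ℝ)| ≤ H by exact_mod_cast hS.e)
  have lA₂ : (1 : ℝ) ≤ S.a₂ := by exact_mod_cast ha₂
  -- `|u| ≤ H ^ 51` bounds the part of the cubic without `y` by a multiple of `H ^ 154`
  set Y : ℝ := (H : ℝ) ^ 160 with hY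
  have hpow : ∀ i j : ℕ, i ≤ j → (H : ℝ) ^ i ≤ H ^ j := fun i j h =>
    pow_le_pow_right₀ (by linarith) h
  have h160 : H ^ 160 ≤ H ^ 410 := pow_le_pow_right₀ (by linarith) (by norm_num)
  have h51 : H ^ 51 ≤ H ^ 410 := pow_le_pow_right₀ (by linarith) (by norm_num)
  have h1Y : (H : ℝ) ^ 1 ≤ Y := hpow 1 160 (by norm_num)
  have h54 : 8 * (H : ℝ) ^ 154 ≤ Y :=
    (pow_mul_pow_le_of_two_le hH' (i := 3) (by norm_num)).trans (hpow 157 160 (by norm_num))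
  refine ⟨u, -Y, ⟨?_, fun j => ?_⟩, huH.mono h51, ?_⟩
  · have k1 := abs_le.1 (abs_mul_le_mul_of_abs_le bA₁ (abs_pow_le_pow_of_abs_le hu 3))
    have k2 := abs_le.1 (abs_mul_le_mul_of_abs_le bB₁ (abs_pow_le_pow_of_abs_le hu 2))
    have k3 := abs_le.1 (abs_mul_le_mul_of_abs_le bC₁ hu)
    have e1 : (H : ℝ) * ((H : ℝ) ^ 51) ^ 3 = H ^ 154 := by ring
    have e2 : (H : ℝ) * ((H : ℝ) ^ 51) ^ 2 ≤ H ^ 154 := by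
      have := hpow 103 154 (by norm_num)
      linarith [(by ring : (H : ℝ) * ((H : ℝ) ^ 51) ^ 2 = H ^ 103)]
    have e3 : (H : ℝ) * (H : ℝ) ^ 51 ≤ H ^ 154 := by
      have := hpow 52 154 (by norm_num); linarith [(by ring : (H : ℝ) * (H : ℝ) ^ 51 = H ^ 52)]
    have e4 := hpow 1 154 (by norm_num)
    have hYH : 4 * (H : ℝ) ≤ Y := by linarith
    have hY1 : 1 ≤ Y := by linarith
    have m1 : (H : ℝ) * Y ^ 2 * 4 ≤ Y ^ 3 := by nlinarith [sq_nonneg Y]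
    have m2 : Y ≤ Y ^ 2 := by nlinarith
    have m3 : (H : ℝ) * Y ≤ H * Y ^ 2 := mul_le_mul_of_nonneg_left m2 (by linarith)
    have m4 : Y ≤ H * Y ^ 2 := by nlinarith
    have m5 : Y ^ 3 ≤ S.a₂ * Y ^ 3 := le_mul_of_one_le_left (by positivity) lA₂
    have m6 : S.b₂ * Y ^ 2 ≤ H * Y ^ 2 := mul_le_mul_of_nonneg_right bB₂.2 (by positivity)
    have m7 : -(H * Y) ≤ S.c₂ * Y := by nlinarith
    have m8 : S.a₂ * (-Y) ^ 3 + S.b₂ * (-Y) ^ 2 + S.c₂ * (-Y)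
        = -(S.a₂ * Y ^ 3) + S.b₂ * Y ^ 2 - S.c₂ * Y := by ring
    unfold cubic
    rw [m8]
    linarith
  · have hj := hul j
    have bα : |(S.α j : ℝ)| ≤ H := by exact_mod_cast hS.α j
    have bγ := abs_le.1 (show |(S.γ j : ℝ)| ≤ H by exact_mod_cast hS.γ j)
    unfold linear
    by_cases h0 : S.β j = 0
    · simpa [h0] using hj
    · have h1 : (1 : ℝ) ≤ S.β j := by
        have := hβ j
        exact_mod_cast (by omega : 1 ≤ S.β j)
      have k1 := abs_le.1 (abs_mul_le_mul_of_abs_le bα hu)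
      have e3 : (H : ℝ) * (H : ℝ) ^ 51 ≤ H ^ 154 := by
        have := hpow 52 154 (by norm_num); linarith [(by ring : (H : ℝ) * (H : ℝ) ^ 51 = H ^ 52)]
      have e4 := hpow 1 154 (by norm_num)
      have : Y ≤ S.β j * Y := le_mul_of_one_le_left (by positivity) h1
      have e0 : (0 : ℝ) ≤ H ^ 154 := by positivity
      linarith
  · refine HeightLE.neg (HeightLE.mono ⟨H ^ 160, 1, one_pos, ?_, ?_, ?_⟩ h160)
    · rw [abs_of_pos (by positivity)]
    · exact one_le_pow₀ (by linarith)
    · rw [hY]; push_cast; ring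

/-- In a feasible set that is bounded from below in the direction of `y`, a point can be moved
vertically, without increasing the cubic, onto a constraint line or to the local minimum of the
`y`-part of the cubic. -/
theorem exists_feasible_vertical {S : CubicSystem m} (ha₂ : 0 < S.a₂) {x y : ℝ}
    (hf : S.Feasible x y) {j : Fin m} (hj : S.β j < 0) :
    ∃ y', S.Feasible x y' ∧ ((∃ k, S.β k ≠ 0 ∧ S.linear k x y' = 0) ∨
      (3 * S.a₂ * y' ^ 2 + 2 * S.b₂ * y' + S.c₂ = 0 ∧ 0 < 3 * S.a₂ * y' + S.b₂)) := by
  have ha : (1 : ℝ) ≤ S.a₂ := by exact_mod_cast ha₂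
  have hb : (S.β j : ℝ) ≤ -1 := by exact_mod_cast (by omega : S.β j ≤ -1)
  set v := S.a₂ * y ^ 3 + S.b₂ * y ^ 2 + S.c₂ * y with hv
  -- beyond `M` the constraint with index `j` fails below, and the cubic exceeds `v` above
  set M : ℝ := 1 + |y| + |S.α j * x + S.γ j| + |(S.b₂ : ℝ)| + |(S.c₂ : ℝ)| + |v| with hM
  have n1 := abs_nonneg y
  have n2 := abs_nonneg (S.α j * x + S.γ j)
  have n3 := abs_nonneg (S.b₂ : ℝ)
  have n4 := abs_nonneg (S.c₂ : ℝ)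
  have n5 := abs_nonneg v
  obtain ⟨t, htM, htI, hle, hcase⟩ := exists_cubic_minimizer (S.a₂ : ℝ) S.b₂ S.c₂
    (fun k => (S.β k : ℝ)) (fun k => S.α k * x + S.γ k) (M := M) (t₀ := y) (by linarith)
    (fun k => by have := hf.2 k; unfold linear at this; linarith)
  refine ⟨t, ⟨?_, fun k => ?_⟩, ?_⟩
  · have := hf.1; unfold cubic at this ⊢; linarith
  · have := htI k; unfold linear; linarith
  rcases hcase with ⟨k, h1, h2⟩ | h | h | ⟨h, -, -⟩
  · exact Or.inl ⟨k, by exact_mod_cast h1, by unfold linear; linarith⟩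
  · exfalso
    have hM1 : 1 ≤ M := by linarith
    rcases (abs_eq (by linarith)).1 h with h1 | h1
    · rw [h1] at hle
      have k1 : -(|(S.b₂ : ℝ)| * M ^ 2) ≤ S.b₂ * M ^ 2 := by
        have := mul_le_mul_of_nonneg_right (neg_abs_le (S.b₂ : ℝ)) (sq_nonneg M); linarith
      have k2 : -(|(S.c₂ : ℝ)| * M) ≤ S.c₂ * M := by
        have := mul_le_mul_of_nonneg_right (neg_abs_le (S.c₂ : ℝ)) (by linarith : 0 ≤ M); linarith
      have k3 : M ^ 3 ≤ S.a₂ * M ^ 3 := le_mul_of_one_le_left (by positivity) ha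
      have k4 : M ≤ M ^ 2 := by nlinarith
      have k5 : |(S.c₂ : ℝ)| * M ≤ |(S.c₂ : ℝ)| * M ^ 2 := mul_le_mul_of_nonneg_left k4 n4
      have k6 : (1 + |v|) * 1 ≤ (1 + |v|) * M ^ 2 :=
        mul_le_mul_of_nonneg_left (by linarith) (by linarith)
      have k7 : (1 + |(S.b₂ : ℝ)| + |(S.c₂ : ℝ)| + |v|) * M ^ 2 ≤ M * M ^ 2 :=
        mul_le_mul_of_nonneg_right (by linarith) (sq_nonneg M)
      have k8 := le_abs_self v
      have k9 : M * M ^ 2 = M ^ 3 := by ring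
      linarith
    · have h2 := htI j
      simp only [h1] at h2
      have := neg_abs_le (S.α j * x + S.γ j)
      nlinarith
  · exact Or.inr h
  · exact absurd h (by linarith)

/-- For positive leading coefficients, a vertical and a horizontal move lead to a constraint line or
to the local minimum of the cubic. -/
theorem hasSmallSolution_of_pos {S : CubicSystem m} {H : ℤ} (hH : 2 ≤ H) (hS : S.BoundedBy H)
    (ha₁ : 0 < S.a₁) (ha₂ : 0 < S.a₂) {x y : ℝ} (hf : S.Feasible x y) :
    S.HasSmallSolution (H ^ 410) := by
  by_cases hβ : ∀ j, 0 ≤ S.β j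
  · exact hasSmallSolution_of_unbounded hH hS ha₂ hf hβ
  by_cases hα : ∀ j, 0 ≤ S.α j
  · exact (hasSmallSolution_of_unbounded hH hS.swap ha₁ hf.swap hα).of_swap
  push Not at hβ hα
  obtain ⟨j, hj⟩ := hβ
  obtain ⟨k, hk⟩ := hα
  obtain ⟨y', hf', ⟨i, hi, hi'⟩ | ⟨hy, hy'⟩⟩ := exists_feasible_vertical ha₂ hf hj
  · exact hasSmallSolution_of_linear_eq_zero hH hS hf' hi' hi
  obtain ⟨x', hf'', ⟨i, hi, hi'⟩ | ⟨hx, hx'⟩⟩ :=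
    exists_feasible_vertical (S := S.swap) ha₁ hf'.swap hk
  · exact (hasSmallSolution_of_linear_eq_zero hH hS.swap hf'' hi' hi).of_swap
  have hfin : S.Feasible x' y' := hf''.swap
  by_cases hline : ∃ i, S.linear i x' y' = 0 ∧ ¬(S.α i = 0 ∧ S.β i = 0)
  · obtain ⟨i, hi, hi'⟩ := hline
    by_cases h0 : S.β i = 0
    · refine (hasSmallSolution_of_linear_eq_zero hH hS.swap hf'' (j := i) ?_ ?_).of_swap
      · unfold linear at hi ⊢; simp only [CubicSystem.swap]; linarith
      · exact fun h => hi' ⟨h, h0⟩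
    · exact hasSmallSolution_of_linear_eq_zero hH hS hfin hi h0
  push Not at hline
  have hA₁ : (0 : ℝ) < S.a₁ := by exact_mod_cast ha₁
  have hA₂ : (0 : ℝ) < S.a₂ := by exact_mod_cast ha₂
  simp only [CubicSystem.swap] at hx hx'
  refine (hasSmallSolution_of_critical hH hS ha₁.ne' ha₂.ne' hx'.le hy'.le ?_ ?_
    (x := x') (y := y') ?_ ?_ hfin ?_).mono (pow_le_pow_right₀ (by linarith) (by norm_num))
  · linear_combination (3 * (S.a₁ : ℝ)) * hx
  · linear_combination (3 * (S.a₂ : ℝ)) * hy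
  · field_simp; ring
  · field_simp; ring
  · intro i
    rcases (hfin.2 i).lt_or_eq with h | h
    · exact Or.inl h
    · exact Or.inr (hline i h)

/-- Every solvable system with `a₁, a₂ ≠ 0` has a small rational solution. -/
theorem hasSmallSolution_of_feasible {S : CubicSystem m} {H : ℤ} (hH : 2 ≤ H) (hS : S.BoundedBy H)
    (ha₁ : S.a₁ ≠ 0) (ha₂ : S.a₂ ≠ 0) {x y : ℝ} (hf : S.Feasible x y) :
    S.HasSmallSolution (H ^ 410) := by
  have key : ∀ {S : CubicSystem m}, S.BoundedBy H → S.a₁ ≠ 0 → 0 < S.a₂ → ∀ {x y : ℝ},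
      S.Feasible x y → S.HasSmallSolution (H ^ 410) := by
    intro S hS h1 h2 x y hf
    rcases lt_or_gt_of_ne h1 with h | h
    · exact (hasSmallSolution_of_pos hH hS.reflect (neg_pos.2 h) h2 hf.reflect).of_reflect
    · exact hasSmallSolution_of_pos hH hS h h2 hf
  rcases lt_or_gt_of_ne ha₂ with h | h
  · exact (key (S := S.swap.reflect.swap) hS.swap.reflect.swap ha₁ (neg_pos.2 h)
      hf.swap.reflect.swap).of_swap.of_reflect.of_swap
  · exact key hS ha₁ h hf

end CubicSystem

/-! ### Sizes of integers and loop-free programs -/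

theorem natAbs_succ_le_two_pow (z : ℤ) : z.natAbs + 1 ≤ 2 ^ Nat.clog 2 (z.natAbs + 1) :=
  Nat.le_pow_clog one_lt_two _

theorem intSize_le_of_succ_le_mul {a b z : ℤ}
    (h : z.natAbs + 1 ≤ (a.natAbs + 1) * (b.natAbs + 1)) : intSize z ≤ intSize a + intSize b := by
  have : Nat.clog 2 (z.natAbs + 1)
      ≤ Nat.clog 2 (a.natAbs + 1) + Nat.clog 2 (b.natAbs + 1) := by
    apply Nat.clog_le_of_le_pow
    rw [pow_add]
    exact h.trans (Nat.mul_le_mul (natAbs_succ_le_two_pow a) (natAbs_succ_le_two_pow b))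
  unfold intSize; omega

theorem intSize_add_le (a b : ℤ) : intSize (a + b) ≤ intSize a + intSize b :=
  intSize_le_of_succ_le_mul (by
    have := Int.natAbs_add_le a b
    have := Nat.zero_le (a.natAbs * b.natAbs)
    linarith)

theorem intSize_sub_le (a b : ℤ) : intSize (a - b) ≤ intSize a + intSize b :=
  intSize_le_of_succ_le_mul (by
    have := Int.natAbs_sub_le a b
    have := Nat.zero_le (a.natAbs * b.natAbs)
    linarith)

theorem intSize_mul_le (a b : ℤ) : intSize (a * b) ≤ intSize a + intSize b :=
  intSize_le_of_succ_le_mul (by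
    rw [Int.natAbs_mul]
    linarith [Nat.zero_le a.natAbs, Nat.zero_le b.natAbs])

theorem intSize_mono {a b : ℤ} (h : a.natAbs ≤ b.natAbs) : intSize a ≤ intSize b :=
  Nat.add_le_add_left (Nat.clog_mono_right 2 (by omega)) 1

theorem intSize_zero : intSize 0 = 1 := by simp [intSize]

theorem intSize_one : intSize 1 = 2 := by
  have : Nat.clog 2 2 = 1 := Nat.clog_eq_one le_rfl le_rfl
  simp [intSize, this]

namespace BitProgram

/-- All registers and all unread inputs have size at most `B`. -/
def State.SizeLE (σ : State) (B : ℕ) : Prop :=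
  (∀ r, intSize (σ.reg r) ≤ B) ∧ ∀ z ∈ σ.tape, intSize z ≤ B

theorem State.SizeLE.mono {σ : State} {B B' : ℕ} (h : σ.SizeLE B) (hB : B ≤ B') : σ.SizeLE B' :=
  ⟨fun r => (h.1 r).trans hB, fun z hz => (h.2 z hz).trans hB⟩

theorem State.SizeLE.set {σ : State} {B : ℕ} (h : σ.SizeLE B) {r : ℕ} {z : ℤ}
    (hz : intSize z ≤ B) : (σ.set r z).SizeLE B := by
  refine ⟨fun s => ?_, h.2⟩
  simp only [State.set, Function.update_apply]
  split_ifs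
  · exact hz
  · exact h.1 s

/-- The program contains no loop. -/
def LoopFree : BitProgram → Prop
  | .seq P Q => P.LoopFree ∧ Q.LoopFree
  | .ifPos _ P Q => P.LoopFree ∧ Q.LoopFree
  | .whilePos _ _ => False
  | _ => True

/-- The final state of a loop-free program (loops are ignored). -/
def run : BitProgram → State → State
  | .skip, σ => σ
  | .const r z, σ => σ.set r z
  | .read r, σ => State.set ⟨σ.reg, σ.tape.tail⟩ r (σ.tape.headD 0)
  | .add r s t, σ => σ.set r (σ.reg s + σ.reg t)
  | .sub r s t, σ => σ.set r (σ.reg s - σ.reg t)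
  | .mul r s t, σ => σ.set r (σ.reg s * σ.reg t)
  | .seq P Q, σ => Q.run (P.run σ)
  | .ifPos r P Q, σ => if 0 < σ.reg r then P.run σ else Q.run σ
  | .whilePos _ _, σ => σ

/-- A fixed loop-free program increases sizes by at most a constant factor, and its running time is
at most quadratic in the size of the data. -/
theorem LoopFree.exists_exec_le {P : BitProgram} (hP : P.LoopFree) :
    ∃ K : ℕ, ∀ (σ : State) (B : ℕ), 1 ≤ B → σ.SizeLE B →
      ∃ t, P.Exec σ t (P.run σ) ∧ t ≤ K * B ^ 2 ∧ (P.run σ).SizeLE ((K + 1) * B) := by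
  have grow : ∀ {B : ℕ} (K : ℕ), B ≤ (K + 1) * B := fun K => Nat.le_mul_of_pos_left _ K.succ_pos
  induction P with
  | skip =>
    exact ⟨1, fun σ B hB h => ⟨1, .skip σ, by nlinarith, h.mono (grow 1)⟩⟩
  | const r z =>
    refine ⟨intSize z, fun σ B hB h =>
      ⟨_, .const σ r z, Nat.le_mul_of_pos_right _ (by positivity), ?_⟩⟩
    exact (h.mono (grow _)).set (by nlinarith)
  | read r =>
    refine ⟨1, fun σ B hB h => ?_⟩
    have hz : intSize (σ.tape.headD 0) ≤ B := by
      rcases hT : σ.tape with _ | ⟨z, l⟩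
      · simpa [intSize_zero] using hB
      · exact h.2 z (by simp [hT])
    refine ⟨_, .read σ r, by nlinarith, ?_⟩
    have h' : (⟨σ.reg, σ.tape.tail⟩ : State).SizeLE ((1 + 1) * B) :=
      State.SizeLE.mono ⟨h.1, fun z hz => h.2 z (List.mem_of_mem_tail hz)⟩ (grow 1)
    exact h'.set (by omega)
  | add r s t =>
    refine ⟨2, fun σ B hB h => ⟨_, .add σ r s t, ?_, ?_⟩⟩
    · have h1 := h.1 s
      have h2 := h.1 t
      nlinarith
    · have h1 := h.1 s
      have h2 := h.1 t
      exact (h.mono (grow _)).set ((intSize_add_le _ _).trans (by omega))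
  | sub r s t =>
    refine ⟨2, fun σ B hB h => ⟨_, .sub σ r s t, ?_, ?_⟩⟩
    · have h1 := h.1 s
      have h2 := h.1 t
      nlinarith
    · have h1 := h.1 s
      have h2 := h.1 t
      exact (h.mono (grow _)).set ((intSize_sub_le _ _).trans (by omega))
  | mul r s t =>
    refine ⟨1, fun σ B hB h => ⟨_, .mul σ r s t, ?_, ?_⟩⟩
    · rw [one_mul, sq]; exact Nat.mul_le_mul (h.1 s) (h.1 t)
    · have h1 := h.1 s
      have h2 := h.1 t
      exact (h.mono (grow _)).set ((intSize_mul_le _ _).trans (by omega))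
  | seq P Q ihP ihQ =>
    obtain ⟨K, hK⟩ := ihP hP.1
    obtain ⟨L, hL⟩ := ihQ hP.2
    refine ⟨K + L * (K + 1) ^ 2 + (L + 1) * (K + 1), fun σ B hB h => ?_⟩
    obtain ⟨t, e1, ht, h1⟩ := hK σ B hB h
    obtain ⟨u, e2, hu, h2⟩ := hL _ ((K + 1) * B) (hB.trans (grow K)) h1
    refine ⟨t + u, .seq e1 e2, ?_, h2.mono ?_⟩
    · calc t + u ≤ K * B ^ 2 + L * ((K + 1) * B) ^ 2 := Nat.add_le_add ht hu
        _ = (K + L * (K + 1) ^ 2) * B ^ 2 := by ring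
        _ ≤ _ := Nat.mul_le_mul_right _ (by omega)
    · rw [← mul_assoc]; exact Nat.mul_le_mul_right _ (by omega)
  | ifPos r P Q ihP ihQ =>
    obtain ⟨K, hK⟩ := ihP hP.1
    obtain ⟨L, hL⟩ := ihQ hP.2
    refine ⟨1 + K + L, fun σ B hB h => ?_⟩
    have hr : intSize (σ.reg r) ≤ B ^ 2 := (h.1 r).trans (by nlinarith)
    by_cases hpos : 0 < σ.reg r
    · obtain ⟨t, e, ht, h1⟩ := hK σ B hB h
      rw [run, if_pos hpos]
      exact ⟨_, .ifPos_true hpos e, by nlinarith, h1.mono (Nat.mul_le_mul_right _ (by omega))⟩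
    · obtain ⟨t, e, ht, h1⟩ := hL σ B hB h
      rw [run, if_neg hpos]
      exact ⟨_, .ifPos_false hpos e, by nlinarith, h1.mono (Nat.mul_le_mul_right _ (by omega))⟩
  | whilePos r P => exact hP.elim

/-! ### The verifier -/

/-- Sequential composition of a list of programs. -/
def block : List BitProgram → BitProgram
  | [] => .skip
  | P :: l => .seq P (block l)

/-- Multiply register `r` by the registers of the list. -/
def mulBy (r : ℕ) : List ℕ → BitProgram
  | [] => .skip
  | s :: l => .seq (.mul r r s) (mulBy r l)

/-- Read a datum of the second variable into register `r`; if there is only one variable, use the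
default value `z`. -/
def readIf (two : Bool) (r : ℕ) (z : ℤ) : BitProgram :=
  if two then .read r else .const r z

/-- The part of the input tape that `readIf two` consumes. -/
def optionalInput (two : Bool) (z : ℤ) : List ℤ :=
  if two then [z] else []

/-- The first part of the verifier: it reads a point `(N₁ / D₁, N₂ / D₂)`, the number of linear
inequalities and the cubic, and sets register `0` to `1` or `0` according to whether the cubic,
multiplied by `D₁³D₂³`, is nonpositive. Register `1` holds the number of inequalities left to check,
registers `2` to `5` hold the point. -/
def checkCubic (two : Bool) : BitProgram :=
  block [.const 0 1, .read 2, .read 3, readIf two 4 0, readIf two 5 1, .read 1,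
    .read 6, mulBy 6 [2, 2, 2, 5, 5, 5], .add 7 7 6,
    .read 6, mulBy 6 [2, 2, 3, 5, 5, 5], .add 7 7 6,
    .read 6, mulBy 6 [2, 3, 3, 5, 5, 5], .add 7 7 6,
    readIf two 6 0, mulBy 6 [4, 4, 4, 3, 3, 3], .add 7 7 6,
    readIf two 6 0, mulBy 6 [4, 4, 5, 3, 3, 3], .add 7 7 6,
    readIf two 6 0, mulBy 6 [4, 5, 5, 3, 3, 3], .add 7 7 6,
    .read 6, mulBy 6 [3, 3, 3, 5, 5, 5], .add 7 7 6,
    .ifPos 7 (.const 0 0) .skip, .const 6 0, .const 7 0]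

/-- One round of the verifier: it reads a linear inequality, sets register `0` to `0` if the linear
form, multiplied by `D₁D₂`, is positive, and decreases the counter in register `1`. -/
def checkLinear (two : Bool) : BitProgram :=
  block [.read 6, mulBy 6 [2, 5], .add 7 7 6, readIf two 6 0, mulBy 6 [4, 3], .add 7 7 6,
    .read 6, mulBy 6 [3, 5], .add 7 7 6,
    .ifPos 7 (.const 0 0) .skip, .const 7 0, .const 6 1, .sub 1 1 6, .const 6 0]

/-- The program that verifies certificates, for two variables or one. -/
def verifier (two : Bool) : BitProgram :=
  .seq (checkCubic two) (.whilePos 1 (checkLinear two))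

/-- The state in which the registers `0` to `7` hold the given numbers and the others hold `0`:
verdict, counter, point, and two working registers. -/
def workState (v k N₁ D₁ N₂ D₂ s w : ℤ) (tape : List ℤ) : State :=
  ⟨fun r => match r with
    | 0 => v
    | 1 => k
    | 2 => N₁
    | 3 => D₁
    | 4 => N₂
    | 5 => D₂
    | 6 => s
    | 7 => w
    | _ => 0, tape⟩

/-- The states of the verifier between two rounds: verdict, counter and point. -/
def roundState (v k N₁ D₁ N₂ D₂ : ℤ) (tape : List ℤ) : State :=
  workState v k N₁ D₁ N₂ D₂ 0 0 tape

section workState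

variable (v k N₁ D₁ N₂ D₂ s w z : ℤ) (l l' : List ℤ)

theorem mk_zero_eq_workState : (⟨fun _ => 0, l⟩ : State) = workState 0 0 0 0 0 0 0 0 l := by
  unfold workState
  congr 1
  funext r
  rcases r with _ | _ | _ | _ | _ | _ | _ | _ | r <;> rfl

theorem mk_workState_reg :
    (⟨(workState v k N₁ D₁ N₂ D₂ s w l).reg, l'⟩ : State) = workState v k N₁ D₁ N₂ D₂ s w l' :=
  rfl

theorem workState_tape : (workState v k N₁ D₁ N₂ D₂ s w l).tape = l := rfl

theorem workState_reg :
    (workState v k N₁ D₁ N₂ D₂ s w l).reg 0 = v ∧ (workState v k N₁ D₁ N₂ D₂ s w l).reg 1 = k ∧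
    (workState v k N₁ D₁ N₂ D₂ s w l).reg 2 = N₁ ∧ (workState v k N₁ D₁ N₂ D₂ s w l).reg 3 = D₁ ∧
    (workState v k N₁ D₁ N₂ D₂ s w l).reg 4 = N₂ ∧ (workState v k N₁ D₁ N₂ D₂ s w l).reg 5 = D₂ ∧
    (workState v k N₁ D₁ N₂ D₂ s w l).reg 6 = s ∧ (workState v k N₁ D₁ N₂ D₂ s w l).reg 7 = w :=
  ⟨rfl, rfl, rfl, rfl, rfl, rfl, rfl, rfl⟩

theorem State.set_eq_of_reg {σ τ : State} {r : ℕ} {z : ℤ} (htape : σ.tape = τ.tape)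
    (h : ∀ i, τ.reg i = if i = r then z else σ.reg i) : σ.set r z = τ := by
  obtain ⟨f, l⟩ := σ
  obtain ⟨g, l'⟩ := τ
  obtain rfl : l = l' := htape
  obtain rfl : g = Function.update f r z := funext fun i => by
    rw [Function.update_apply]; exact h i
  rfl

theorem workState_set :
    (workState v k N₁ D₁ N₂ D₂ s w l).set 0 z = workState z k N₁ D₁ N₂ D₂ s w l ∧
    (workState v k N₁ D₁ N₂ D₂ s w l).set 1 z = workState v z N₁ D₁ N₂ D₂ s w l ∧
    (workState v k N₁ D₁ N₂ D₂ s w l).set 2 z = workState v k z D₁ N₂ D₂ s w l ∧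
    (workState v k N₁ D₁ N₂ D₂ s w l).set 3 z = workState v k N₁ z N₂ D₂ s w l ∧
    (workState v k N₁ D₁ N₂ D₂ s w l).set 4 z = workState v k N₁ D₁ z D₂ s w l ∧
    (workState v k N₁ D₁ N₂ D₂ s w l).set 5 z = workState v k N₁ D₁ N₂ z s w l ∧
    (workState v k N₁ D₁ N₂ D₂ s w l).set 6 z = workState v k N₁ D₁ N₂ D₂ z w l ∧
    (workState v k N₁ D₁ N₂ D₂ s w l).set 7 z = workState v k N₁ D₁ N₂ D₂ s z l := by
  refine ⟨?_, ?_, ?_, ?_, ?_, ?_, ?_, ?_⟩ <;>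
    refine State.set_eq_of_reg rfl fun i => ?_ <;>
    rcases i with _ | _ | _ | _ | _ | _ | _ | _ | i <;> simp [workState]

end workState

/-- The cubic at `(N₁ / D₁, N₂ / D₂)`, multiplied by `D₁³D₂³`. -/
def clearedCubic (N₁ D₁ N₂ D₂ a₁ b₁ c₁ a₂ b₂ c₂ e : ℤ) : ℤ :=
  a₁ * N₁ * N₁ * N₁ * D₂ * D₂ * D₂ + b₁ * N₁ * N₁ * D₁ * D₂ * D₂ * D₂
    + c₁ * N₁ * D₁ * D₁ * D₂ * D₂ * D₂ + a₂ * N₂ * N₂ * N₂ * D₁ * D₁ * D₁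
    + b₂ * N₂ * N₂ * D₂ * D₁ * D₁ * D₁ + c₂ * N₂ * D₂ * D₂ * D₁ * D₁ * D₁
    + e * D₁ * D₁ * D₁ * D₂ * D₂ * D₂

/-- A linear form at `(N₁ / D₁, N₂ / D₂)`, multiplied by `D₁D₂`. -/
def clearedLinear (N₁ D₁ N₂ D₂ α β γ : ℤ) : ℤ :=
  α * N₁ * D₂ + β * N₂ * D₁ + γ * D₁ * D₂

theorem loopFree_checkCubic (two : Bool) : (checkCubic two).LoopFree := by
  cases two <;> simp [checkCubic, block, mulBy, readIf, LoopFree]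

theorem loopFree_checkLinear (two : Bool) : (checkLinear two).LoopFree := by
  cases two <;> simp [checkLinear, block, mulBy, readIf, LoopFree]

theorem run_checkCubic {two : Bool} {N₁ D₁ N₂ D₂ k a₁ b₁ c₁ a₂ b₂ c₂ e : ℤ} {rest : List ℤ}
    (htwo : two = false → N₂ = 0 ∧ D₂ = 1 ∧ a₂ = 0 ∧ b₂ = 0 ∧ c₂ = 0) :
    (checkCubic two).run ⟨fun _ => 0, [N₁, D₁] ++ optionalInput two N₂ ++ optionalInput two D₂
        ++ [k] ++ [a₁, b₁, c₁] ++ optionalInput two a₂ ++ optionalInput two b₂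
        ++ optionalInput two c₂ ++ [e] ++ rest⟩
      = roundState (if 0 < clearedCubic N₁ D₁ N₂ D₂ a₁ b₁ c₁ a₂ b₂ c₂ e then 0 else 1)
          k N₁ D₁ N₂ D₂ rest := by
  cases two
  on_goal 1 => obtain ⟨rfl, rfl, rfl, rfl, rfl⟩ := htwo rfl
  all_goals
    simp only [checkCubic, block, mulBy, readIf, optionalInput, run, roundState, clearedCubic,
      mk_zero_eq_workState, mk_workState_reg, workState_tape, workState_reg, workState_set,
      List.cons_append, List.nil_append, List.headD_cons, List.tail_cons, zero_add,
      Bool.false_eq_true, if_true, if_false, zero_mul, add_zero, mul_one]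
    split_ifs with h <;> simp only [workState_set, h, if_true, if_false]

theorem run_checkLinear {two : Bool} {v k N₁ D₁ N₂ D₂ α β γ : ℤ} {rest : List ℤ}
    (htwo : two = false → β = 0) :
    (checkLinear two).run (roundState v k N₁ D₁ N₂ D₂ ([α] ++ optionalInput two β ++ [γ] ++ rest))
      = roundState (if 0 < clearedLinear N₁ D₁ N₂ D₂ α β γ then 0 else v)
          (k - 1) N₁ D₁ N₂ D₂ rest := by
  cases two
  on_goal 1 => obtain rfl := htwo rfl
  all_goals
    simp only [checkLinear, block, mulBy, readIf, optionalInput, run, roundState, clearedLinear,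
      mk_workState_reg, workState_tape, workState_reg, workState_set, List.cons_append,
      List.nil_append, List.headD_cons, List.tail_cons, zero_add, Bool.false_eq_true, if_true,
      if_false, zero_mul, add_zero]
    split_ifs with h <;> simp only [workState_set, workState_reg, h, if_true, if_false]

/-- The tape segment with the coefficients of a linear inequality. -/
def linearTape (two : Bool) (p : ℤ × ℤ × ℤ) : List ℤ :=
  [p.1] ++ optionalInput two p.2.1 ++ [p.2.2]

theorem sizeLE_roundState {v k N₁ D₁ N₂ D₂ : ℤ} {l : List ℤ} {B : ℕ} (hB : 1 ≤ B)
    (hv : intSize v ≤ B) (hk : intSize k ≤ B) (h₁ : intSize N₁ ≤ B) (h₂ : intSize D₁ ≤ B)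
    (h₃ : intSize N₂ ≤ B) (h₄ : intSize D₂ ≤ B) (hl : ∀ z ∈ l, intSize z ≤ B) :
    (roundState v k N₁ D₁ N₂ D₂ l).SizeLE B := by
  refine ⟨fun r => ?_, hl⟩
  have h0 : intSize 0 ≤ B := by rwa [intSize_zero]
  rcases r with _ | _ | _ | _ | _ | _ | _ | _ | r <;> assumption

/-- The loop of the verifier takes one round for each linear inequality, and all rounds start from
states of the same size. -/
theorem exists_exec_checkLinear_loop (two : Bool) :
    ∃ K : ℕ, ∀ (N₁ D₁ N₂ D₂ : ℤ) (B : ℕ), 2 ≤ B → intSize N₁ ≤ B → intSize D₁ ≤ B →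
      intSize N₂ ≤ B → intSize D₂ ≤ B → ∀ (L : List (ℤ × ℤ × ℤ)) (v : ℤ), v = 0 ∨ v = 1 →
      intSize L.length ≤ B → (∀ z ∈ L.flatMap (linearTape two), intSize z ≤ B) →
      (∀ p ∈ L, two = false → p.2.1 = 0) →
      ∃ t τ, Exec (.whilePos 1 (checkLinear two))
          (roundState v L.length N₁ D₁ N₂ D₂ (L.flatMap (linearTape two))) t τ ∧
        t ≤ (L.length + 1) * (K * B ^ 2) ∧
        (0 < τ.reg 0 ↔ 0 < v ∧ ∀ p ∈ L, clearedLinear N₁ D₁ N₂ D₂ p.1 p.2.1 p.2.2 ≤ 0) := by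
  obtain ⟨K, hK⟩ := (loopFree_checkLinear two).exists_exec_le
  refine ⟨K + 1, fun N₁ D₁ N₂ D₂ B hB hN₁ hD₁ hN₂ hD₂ L => ?_⟩
  have hBB : B ≤ B ^ 2 := by nlinarith
  induction L with
  | nil =>
    intro v _ hL _ _
    refine ⟨_, _, .while_false (r := 1) (by simp [roundState, workState]), ?_, ?_⟩
    · have : intSize ((roundState v ([] : List (ℤ × ℤ × ℤ)).length N₁ D₁ N₂ D₂
          (([] : List (ℤ × ℤ × ℤ)).flatMap (linearTape two))).reg 1) ≤ B := hL
      refine this.trans (hBB.trans ?_)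
      simp only [List.length_nil, zero_add, one_mul]
      exact Nat.le_mul_of_pos_left _ K.succ_pos
    · simp [roundState, workState]
  | cons p L ih =>
    intro v hv hL htape htwo
    have hv' : intSize v ≤ B := by
      rcases hv with rfl | rfl
      · rw [intSize_zero]; omega
      · rwa [intSize_one]
    have hstep := run_checkLinear (two := two) (v := v) (k := (p :: L).length) (N₁ := N₁) (D₁ := D₁)
      (N₂ := N₂) (D₂ := D₂) (α := p.1) (β := p.2.1) (γ := p.2.2)
      (rest := L.flatMap (linearTape two)) (htwo p (by simp))
    obtain ⟨t, e, ht, -⟩ := hK _ B (by omega) (sizeLE_roundState (by omega) hv' hL hN₁ hD₁ hN₂ hD₂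
      htape)
    rw [List.flatMap_cons] at e
    change Exec _ _ _ (run _ (roundState v _ N₁ D₁ N₂ D₂
      ([p.1] ++ optionalInput two p.2.1 ++ [p.2.2] ++ _))) at e
    rw [hstep] at e
    have hlen : ((p :: L).length : ℤ) - 1 = L.length := by simp
    rw [hlen] at e
    obtain ⟨u, τ, e', hu, hτ⟩ := ih (if 0 < clearedLinear N₁ D₁ N₂ D₂ p.1 p.2.1 p.2.2 then 0 else v)
      (by split_ifs; exacts [Or.inl rfl, hv])
      ((intSize_mono (by rw [List.length_cons]; omega)).trans hL)
      (fun z hz => htape z (by rw [List.flatMap_cons]; exact List.mem_append_right _ hz))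
      (fun q hq => htwo q (List.mem_cons_of_mem _ hq))
    refine ⟨_, τ, .while_true (r := 1) ?_ e e', ?_, ?_⟩
    · simp [roundState, workState]
    · have h1 : intSize ((roundState v ((p :: L).length : ℕ) N₁ D₁ N₂ D₂
          ((p :: L).flatMap (linearTape two))).reg 1) ≤ B := hL
      calc _ ≤ B ^ 2 + K * B ^ 2 + (L.length + 1) * ((K + 1) * B ^ 2) :=
            Nat.add_le_add (Nat.add_le_add (h1.trans hBB) ht) hu
        _ = _ := by rw [List.length_cons]; ring
    · rw [hτ]
      split_ifs with h
      · simp [h]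
      · simp [not_lt.1 h]

/-- The verifier decides the system at a given point, in time linear in the number of inequalities
and quadratic in the size of the numbers. -/
theorem exists_exec_verifier (two : Bool) :
    ∃ K : ℕ, ∀ (N₁ D₁ N₂ D₂ a₁ b₁ c₁ a₂ b₂ c₂ e : ℤ) (L : List (ℤ × ℤ × ℤ)) (A : Prop),
      (two = false → N₂ = 0 ∧ D₂ = 1 ∧ a₂ = 0 ∧ b₂ = 0 ∧ c₂ = 0 ∧ ∀ p ∈ L, p.2.1 = 0) →
      (A ↔ clearedCubic N₁ D₁ N₂ D₂ a₁ b₁ c₁ a₂ b₂ c₂ e ≤ 0 ∧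
        ∀ p ∈ L, clearedLinear N₁ D₁ N₂ D₂ p.1 p.2.1 p.2.2 ≤ 0) →
      ∀ B, 2 ≤ B → (∀ z ∈ [N₁, D₁] ++ optionalInput two N₂ ++ optionalInput two D₂ ++
          [(L.length : ℤ)] ++ [a₁, b₁, c₁] ++ optionalInput two a₂ ++ optionalInput two b₂ ++
          optionalInput two c₂ ++ [e] ++ L.flatMap (linearTape two), intSize z ≤ B) →
        ∃ t, (verifier two).DecidesIn ([N₁, D₁] ++ optionalInput two N₂ ++ optionalInput two D₂ ++
            [(L.length : ℤ)] ++ [a₁, b₁, c₁] ++ optionalInput two a₂ ++ optionalInput two b₂ ++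
            optionalInput two c₂ ++ [e] ++ L.flatMap (linearTape two)) A t ∧
          t ≤ (L.length + 1) * (K * B ^ 2) := by
  obtain ⟨K, hK⟩ := (loopFree_checkCubic two).exists_exec_le
  obtain ⟨K', hK'⟩ := exists_exec_checkLinear_loop two
  refine ⟨K + K', fun N₁ D₁ N₂ D₂ a₁ b₁ c₁ a₂ b₂ c₂ e L A htwo hA B hB htape => ?_⟩
  have h0 : intSize 0 ≤ B := by rw [intSize_zero]; omega
  obtain ⟨t, ex, ht, -⟩ := hK ⟨fun _ => 0, _⟩ B (by omega) ⟨fun _ => h0, htape⟩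
  rw [run_checkCubic fun h => ⟨(htwo h).1, (htwo h).2.1, (htwo h).2.2.1, (htwo h).2.2.2.1,
    (htwo h).2.2.2.2.1⟩] at ex
  have hN₂ : intSize N₂ ≤ B := by
    cases two
    · rwa [(htwo rfl).1]
    · exact htape _ (by simp [optionalInput])
  have hD₂ : intSize D₂ ≤ B := by
    cases two
    · rwa [(htwo rfl).2.1, intSize_one]
    · exact htape _ (by simp [optionalInput])
  obtain ⟨u, τ, ex', hu, hτ⟩ := hK' N₁ D₁ N₂ D₂ B hB (htape _ (by simp)) (htape _ (by simp)) hN₂ hD₂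
    L (if 0 < clearedCubic N₁ D₁ N₂ D₂ a₁ b₁ c₁ a₂ b₂ c₂ e then 0 else 1)
    (by split_ifs <;> simp) (htape _ (by simp))
    (fun z hz => htape z (List.mem_append_right _ hz)) (fun p hp h => (htwo h).2.2.2.2.2 p hp)
  refine ⟨t + u, ⟨τ, .seq ex ex', ?_⟩, ?_⟩
  · rw [hτ, hA]
    split_ifs with h
    · simp [h]
    · simp [not_lt.1 h]
  · calc t + u ≤ K * B ^ 2 + (L.length + 1) * (K' * B ^ 2) := Nat.add_le_add ht hu
      _ ≤ (L.length + 1) * (K * B ^ 2) + (L.length + 1) * (K' * B ^ 2) :=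
          Nat.add_le_add_right (Nat.le_mul_of_pos_left _ (by omega)) _
      _ = _ := by ring

end BitProgram

namespace BitProgram

theorem clearedCubic_nonpos_iff {N₁ D₁ N₂ D₂ a₁ b₁ c₁ a₂ b₂ c₂ e : ℤ} (hD₁ : 0 < D₁)
    (hD₂ : 0 < D₂) {x y : ℝ} (hx : x = N₁ / D₁) (hy : y = N₂ / D₂) :
    clearedCubic N₁ D₁ N₂ D₂ a₁ b₁ c₁ a₂ b₂ c₂ e ≤ 0 ↔
      a₁ * x ^ 3 + b₁ * x ^ 2 + c₁ * x + (a₂ * y ^ 3 + b₂ * y ^ 2 + c₂ * y) + e ≤ 0 := by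
  have h₁ : (0 : ℝ) < D₁ := by exact_mod_cast hD₁
  have h₂ : (0 : ℝ) < D₂ := by exact_mod_cast hD₂
  have key : (clearedCubic N₁ D₁ N₂ D₂ a₁ b₁ c₁ a₂ b₂ c₂ e : ℝ) = D₁ ^ 3 * D₂ ^ 3 *
      (a₁ * x ^ 3 + b₁ * x ^ 2 + c₁ * x + (a₂ * y ^ 3 + b₂ * y ^ 2 + c₂ * y) + e) := by
    rw [hx, hy]; unfold clearedCubic; push_cast; field_simp; ring
  rw [← Int.cast_le (R := ℝ), key, Int.cast_zero]
  exact ⟨fun h => nonpos_of_mul_nonpos_right h (by positivity),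
    mul_nonpos_of_nonneg_of_nonpos (by positivity)⟩

theorem clearedLinear_nonpos_iff {N₁ D₁ N₂ D₂ α β γ : ℤ} (hD₁ : 0 < D₁) (hD₂ : 0 < D₂) {x y : ℝ}
    (hx : x = N₁ / D₁) (hy : y = N₂ / D₂) :
    clearedLinear N₁ D₁ N₂ D₂ α β γ ≤ 0 ↔ α * x + β * y + γ ≤ 0 := by
  have h₁ : (0 : ℝ) < D₁ := by exact_mod_cast hD₁
  have h₂ : (0 : ℝ) < D₂ := by exact_mod_cast hD₂
  have key : (clearedLinear N₁ D₁ N₂ D₂ α β γ : ℝ) = D₁ * D₂ * (α * x + β * y + γ) := by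
    rw [hx, hy]; unfold clearedLinear; push_cast; field_simp
  rw [← Int.cast_le (R := ℝ), key, Int.cast_zero]
  exact ⟨fun h => nonpos_of_mul_nonpos_right h (by positivity),
    mul_nonpos_of_nonneg_of_nonpos (by positivity)⟩

end BitProgram

/-! ### Coefficients and values of the polynomials -/

section polynomials

variable {n m : ℕ}

theorem coeff_separableCubic (a b c d : Fin n → ℤ) (e : Fin n →₀ ℕ) :
    (separableCubic a b c d).coeff e = ∑ i, ((a i * if Finsupp.single i 3 = e then 1 else 0)
      + (b i * if Finsupp.single i 2 = e then 1 else 0)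
      + (c i * if Finsupp.single i 1 = e then 1 else 0) + if 0 = e then d i else 0) := by
  simp only [separableCubic, MvPolynomial.coeff_sum, MvPolynomial.coeff_add,
    MvPolynomial.coeff_C_mul, MvPolynomial.coeff_X_pow, MvPolynomial.coeff_X,
    MvPolynomial.coeff_C]

theorem coeff_single_three_separableCubic (a b c d : Fin n → ℤ) (i : Fin n) :
    (separableCubic a b c d).coeff (Finsupp.single i 3) = a i := by
  simp [coeff_separableCubic, Finsupp.single_eq_single_iff, eq_comm (a := (0 : Fin n →₀ ℕ))]

theorem coeff_single_two_separableCubic (a b c d : Fin n → ℤ) (i : Fin n) :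
    (separableCubic a b c d).coeff (Finsupp.single i 2) = b i := by
  simp [coeff_separableCubic, Finsupp.single_eq_single_iff, eq_comm (a := (0 : Fin n →₀ ℕ))]

theorem coeff_single_one_separableCubic (a b c d : Fin n → ℤ) (i : Fin n) :
    (separableCubic a b c d).coeff (Finsupp.single i 1) = c i := by
  simp [coeff_separableCubic, Finsupp.single_eq_single_iff, eq_comm (a := (0 : Fin n →₀ ℕ))]

theorem coeff_zero_separableCubic (a b c d : Fin n → ℤ) :
    (separableCubic a b c d).coeff 0 = ∑ i, d i := by
  simp [coeff_separableCubic]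

theorem aeval_separableCubic (a b c d : Fin n → ℤ) (x : Fin n → ℝ) :
    MvPolynomial.aeval x (separableCubic a b c d)
      = ∑ i, (a i * x i ^ 3 + b i * x i ^ 2 + c i * x i + d i) := by
  simp [separableCubic]

theorem eq_sum_of_totalDegree_le_one {f : MvPolynomial (Fin n) ℤ} (hf : f.totalDegree ≤ 1) :
    f = ∑ i, MvPolynomial.C (f.coeff (Finsupp.single i 1)) * MvPolynomial.X i
      + MvPolynomial.C (f.coeff 0) := by
  ext e
  simp only [MvPolynomial.coeff_add, MvPolynomial.coeff_sum, MvPolynomial.coeff_C_mul,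
    MvPolynomial.coeff_X, MvPolynomial.coeff_C]
  by_cases h0 : e = 0
  · subst h0; simp
  by_cases h1 : ∃ i, Finsupp.single i 1 = e
  · obtain ⟨i, rfl⟩ := h1
    simp [Finsupp.single_eq_single_iff, eq_comm]
  push Not at h1
  rw [MvPolynomial.coeff_eq_zero_of_totalDegree_lt]
  · simp [h1, Ne.symm h0]
  · refine hf.trans_lt ?_
    by_contra hcon
    push Not at hcon
    have hd : e.degree ≤ 1 := hcon
    rcases Nat.le_one_iff_eq_zero_or_eq_one.1 hd with h | h
    · exact h0 ((Finsupp.degree_eq_zero_iff e).1 h)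
    · obtain ⟨i, hi⟩ := (Finsupp.sum_eq_one_iff e).1 h
      exact h1 i hi.symm

theorem aeval_of_totalDegree_le_one {f : MvPolynomial (Fin n) ℤ} (hf : f.totalDegree ≤ 1)
    (x : Fin n → ℝ) : MvPolynomial.aeval x f
      = ∑ i, ((f.coeff (Finsupp.single i 1) : ℤ) : ℝ) * x i + ((f.coeff 0 : ℤ) : ℝ) := by
  conv_lhs => rw [eq_sum_of_totalDegree_le_one hf]
  simp

end polynomials

/-! ### Sizes of solutions and of inputs -/

theorem HeightLE.exists_rat {B : ℤ} {x : ℝ} (h : HeightLE B x) :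
    ∃ r : ℚ, (r : ℝ) = x ∧ ratSize r ≤ 1 + 2 * Nat.clog 2 (B.natAbs + 1) := by
  obtain ⟨N, D, hD, hN, hDB, rfl⟩ := h
  rw [Int.abs_eq_natAbs] at hN
  refine ⟨Rat.divInt N D, by rw [Rat.divInt_eq_div]; push_cast; rfl, ?_⟩
  have hnum : (Rat.divInt N D).num.natAbs ≤ B.natAbs := by
    have h1 : (Rat.divInt N D).num.natAbs ∣ N.natAbs :=
      Int.natAbs_dvd_natAbs.2 (Rat.num_dvd N hD.ne')
    rcases eq_or_ne N 0 with rfl | h0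
    · simp
    · exact (Nat.le_of_dvd (Int.natAbs_pos.2 h0) h1).trans (by omega)
  have hden : (Rat.divInt N D).den ≤ B.natAbs := by
    have h1 : ((Rat.divInt N D).den : ℤ) ≤ D := Int.le_of_dvd hD (Rat.den_dvd N D)
    omega
  have h2 := Nat.clog_mono_right 2 (Nat.succ_le_succ hnum)
  have h3 := Nat.clog_mono_right 2 (Nat.succ_le_succ hden)
  unfold ratSize
  simp only [Nat.succ_eq_add_one] at h2 h3
  omega

theorem clog_pow_add_one_le {H : ℤ} (hH : 2 ≤ H) (k : ℕ) :
    Nat.clog 2 ((H ^ k).natAbs + 1) ≤ k * Nat.clog 2 H.natAbs + 1 := by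
  apply Nat.clog_le_of_le_pow
  rw [Int.natAbs_pow, pow_succ, mul_comm k, pow_mul]
  have h1 : H.natAbs ^ k ≤ (2 ^ Nat.clog 2 H.natAbs) ^ k :=
    Nat.pow_le_pow_left (Nat.le_pow_clog one_lt_two _) k
  have h2 : 1 ≤ H.natAbs ^ k := Nat.one_le_pow _ _ (by omega)
  omega

theorem clog_floor_add_one_le {H : ℝ} (hH : 1 ≤ H) :
    (Nat.clog 2 (⌊H⌋ + 1).natAbs : ℝ) ≤ 3 + 2 * Real.log H := by
  set z := (⌊H⌋ + 1).natAbs with hz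
  have hfl : 1 ≤ ⌊H⌋ := Int.le_floor.2 (by simpa using hH)
  have hz2 : 2 ≤ z := by omega
  have hzH : (z : ℝ) ≤ 2 * H := by
    have h1 : ((z : ℤ) : ℝ) = (⌊H⌋ : ℝ) + 1 := by
      have : (z : ℤ) = ⌊H⌋ + 1 := by omega
      rw [this]; push_cast; ring
    have h2 := Int.floor_le H
    rw [Int.cast_natCast] at h1
    linarith
  have hpow : 2 ^ (Nat.clog 2 z - 1) < z := Nat.pow_pred_clog_lt_self one_lt_two (by omega)
  have hpow' : (2 : ℝ) ^ (Nat.clog 2 z - 1) ≤ 2 * H := by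
    have : ((2 ^ (Nat.clog 2 z - 1) : ℕ) : ℝ) ≤ z := by exact_mod_cast hpow.le
    push_cast at this
    linarith
  have hlog := Real.log_le_log (by positivity) hpow'
  rw [Real.log_pow, Real.log_mul two_ne_zero (by linarith)] at hlog
  have hcl : 1 ≤ Nat.clog 2 z := Nat.clog_pos one_lt_two hz2
  rw [Nat.cast_sub hcl, Nat.cast_one] at hlog
  have l1 := Real.log_two_gt_d9
  have l3 := Real.log_nonneg hH
  have l4 : (1 : ℝ) ≤ Nat.clog 2 z := by exact_mod_cast hcl
  nlinarith

theorem intSize_natCast_le (m : ℕ) : intSize m ≤ m + 2 := by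
  have : Nat.clog 2 (m + 1) ≤ m + 1 :=
    Nat.clog_le_of_le_pow (Nat.lt_two_pow_self.le)
  simp only [intSize, Int.natAbs_natCast]; omega

theorem CoeffsBoundedBy.abs_coeff_le {n : ℕ} {H : ℝ} {g : MvPolynomial (Fin n) ℤ}
    (h : CoeffsBoundedBy H g) (e : Fin n →₀ ℕ) : |g.coeff e| ≤ ⌊H⌋ :=
  Int.le_floor.2 (by rw [Int.cast_abs]; exact h e)

theorem intSize_le_of_abs_le_floor {H : ℝ} {z : ℤ} (h : |z| ≤ ⌊H⌋) :
    intSize z ≤ 1 + Nat.clog 2 (⌊H⌋ + 1).natAbs :=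
  Nat.add_le_add_left (Nat.clog_mono_right 2 (by rw [Int.abs_eq_natAbs] at h; omega)) 1

theorem ratSize_le_vecSize {n : ℕ} (x : Fin n → ℚ) (i : Fin n) : ratSize (x i) ≤ vecSize x :=
  (Finset.single_le_sum (f := fun i => ratSize (x i)) (fun _ _ => Nat.zero_le _)
    (Finset.mem_univ i)).trans (Nat.le_add_left _ _)

theorem intSize_le_of_mem_certificateInput {n m : ℕ} {x : Fin n → ℚ} {g : MvPolynomial (Fin n) ℤ}
    {f : Fin m → MvPolynomial (Fin n) ℤ} {H : ℝ} (hg : CoeffsBoundedBy H g)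
    (hf : ∀ j, CoeffsBoundedBy H (f j)) {z : ℤ} (hz : z ∈ certificateInput x g f) :
    intSize z ≤ vecSize x + m + Nat.clog 2 (⌊H⌋ + 1).natAbs + 2 := by
  have hc : ∀ {w : ℤ}, |w| ≤ ⌊H⌋ → intSize w ≤ vecSize x + m + Nat.clog 2 (⌊H⌋ + 1).natAbs + 2 :=
    fun h => (intSize_le_of_abs_le_floor h).trans (by omega)
  simp only [certificateInput, List.mem_append, List.mem_flatten, List.mem_ofFn', Set.mem_range,
    exists_exists_eq_and, List.mem_cons, List.not_mem_nil, or_false] at hz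
  rcases hz with (((⟨i, rfl | rfl⟩ | rfl) | ⟨i, rfl | rfl | rfl⟩) | rfl) | ⟨j, ⟨i, rfl⟩ | rfl⟩
  · have := ratSize_le_vecSize x i
    unfold ratSize at this
    unfold intSize; omega
  · have := ratSize_le_vecSize x i
    unfold ratSize at this
    unfold intSize; rw [Int.natAbs_natCast]; omega
  · exact (intSize_natCast_le m).trans (by omega)
  · exact hc (hg.abs_coeff_le _)
  · exact hc (hg.abs_coeff_le _)
  · exact hc (hg.abs_coeff_le _)
  · exact hc (hg.abs_coeff_le _)
  · exact hc ((hf j).abs_coeff_le _)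
  · exact hc ((hf j).abs_coeff_le _)

/-! ### One and two variables -/

theorem exists_small_real_solution_one {m : ℕ} {f : Fin m → MvPolynomial (Fin 1) ℤ}
    {a b c d : Fin 1 → ℤ} {H : ℤ} (hH : 2 ≤ H) (hdeg : ∀ j, (f j).totalDegree ≤ 1)
    (hg : ∀ e, |(separableCubic a b c d).coeff e| ≤ H) (hf : ∀ j e, |(f j).coeff e| ≤ H)
    (hne : (feasibleSet (separableCubic a b c d) f).Nonempty) :
    ∃ x ∈ feasibleSet (separableCubic a b c d) f, ∀ i, HeightLE (H ^ 410) (x i) := by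
  obtain ⟨x, hx, hl⟩ := hne
  rw [aeval_separableCubic] at hx
  simp only [aeval_of_totalDegree_le_one (hdeg _), Fin.sum_univ_one] at hx hl
  have hA : ∀ i, |a i| ≤ H := fun i => by
    rw [← coeff_single_three_separableCubic a b c d i]; exact hg _
  have hB : ∀ i, |b i| ≤ H := fun i => by
    rw [← coeff_single_two_separableCubic a b c d i]; exact hg _
  have hC : ∀ i, |c i| ≤ H := fun i => by
    rw [← coeff_single_one_separableCubic a b c d i]; exact hg _
  have hD := hg 0
  rw [coeff_zero_separableCubic, Fin.sum_univ_one] at hD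
  obtain ⟨t, h1, h2, h3⟩ := exists_small_solution_of_univariate hH (hA 0) (hB 0) (hC 0) hD
    (fun j => hf j _) (fun j => hf j _) hx hl
  refine ⟨fun _ => t, ⟨?_, fun j => ?_⟩,
    fun _ => h3.mono (pow_le_pow_right₀ (by linarith) (by norm_num))⟩
  · rwa [aeval_separableCubic, Fin.sum_univ_one]
  · rw [aeval_of_totalDegree_le_one (hdeg j), Fin.sum_univ_one]; exact h2 j

theorem exists_small_real_solution_two {m : ℕ} {f : Fin m → MvPolynomial (Fin 2) ℤ}
    {a b c d : Fin 2 → ℤ} {H : ℤ} (hH : 2 ≤ H) (hdeg : ∀ j, (f j).totalDegree ≤ 1)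
    (ha : ∀ i, a i ≠ 0) (hg : ∀ e, |(separableCubic a b c d).coeff e| ≤ H)
    (hf : ∀ j e, |(f j).coeff e| ≤ H)
    (hne : (feasibleSet (separableCubic a b c d) f).Nonempty) :
    ∃ x ∈ feasibleSet (separableCubic a b c d) f, ∀ i, HeightLE (H ^ 410) (x i) := by
  let S : CubicSystem m := ⟨a 0, b 0, c 0, a 1, b 1, c 1, d 0 + d 1,
    fun j => (f j).coeff (Finsupp.single 0 1), fun j => (f j).coeff (Finsupp.single 1 1),
    fun j => (f j).coeff 0⟩
  have hS : ∀ x : Fin 2 → ℝ, x ∈ feasibleSet (separableCubic a b c d) f ↔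
      S.Feasible (x 0) (x 1) := by
    intro x
    unfold feasibleSet CubicSystem.Feasible
    rw [Set.mem_ofPred_eq]
    refine and_congr ?_ (forall_congr' fun j => ?_)
    · rw [aeval_separableCubic, Fin.sum_univ_two]
      simp only [CubicSystem.cubic, S]
      push_cast
      constructor <;> intro h <;> linarith
    · rw [aeval_of_totalDegree_le_one (hdeg j), Fin.sum_univ_two]
      rfl
  have hA : ∀ i, |a i| ≤ H := fun i => by
    rw [← coeff_single_three_separableCubic a b c d i]; exact hg _
  have hB : ∀ i, |b i| ≤ H := fun i => by
    rw [← coeff_single_two_separableCubic a b c d i]; exact hg _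
  have hC : ∀ i, |c i| ≤ H := fun i => by
    rw [← coeff_single_one_separableCubic a b c d i]; exact hg _
  have hD := hg 0
  rw [coeff_zero_separableCubic, Fin.sum_univ_two] at hD
  have hBd : S.BoundedBy H := ⟨hA 0, hB 0, hC 0, hA 1, hB 1, hC 1, hD, fun j => hf j _,
    fun j => hf j _, fun j => hf j _⟩
  obtain ⟨x, hx⟩ := hne
  obtain ⟨u, v, h1, h2, h3⟩ :=
    CubicSystem.hasSmallSolution_of_feasible hH hBd (ha 0) (ha 1) ((hS x).1 hx)
  refine ⟨![u, v], (hS _).2 h1, fun i => ?_⟩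
  fin_cases i
  · exact h2
  · exact h3

open BitProgram in
theorem exists_decidesIn_one : ∃ K : ℕ, ∀ (m : ℕ) (f : Fin m → MvPolynomial (Fin 1) ℤ)
    (a b c d : Fin 1 → ℤ) (x : Fin 1 → ℚ) (B : ℕ), (∀ j, (f j).totalDegree ≤ 1) → 2 ≤ B →
    (∀ z ∈ certificateInput x (separableCubic a b c d) f, intSize z ≤ B) →
    ∃ t, (verifier false).DecidesIn (certificateInput x (separableCubic a b c d) f)
        ((fun i => (x i : ℝ)) ∈ feasibleSet (separableCubic a b c d) f) t ∧
      t ≤ (m + 1) * (K * B ^ 2) := by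
  obtain ⟨K, hK⟩ := exists_exec_verifier false
  refine ⟨K, fun m f a b c d x B hdeg hB htape => ?_⟩
  set L : List (ℤ × ℤ × ℤ) :=
    List.ofFn fun j => ((f j).coeff (Finsupp.single 0 1), 0, (f j).coeff 0) with hL
  have hlen : L.length = m := by simp [hL]
  have hin : certificateInput x (separableCubic a b c d) f = [(x 0).num, ((x 0).den : ℤ)]
      ++ optionalInput false 0 ++ optionalInput false 1 ++ [(L.length : ℤ)] ++ [a 0, b 0, c 0]
      ++ optionalInput false 0 ++ optionalInput false 0 ++ optionalInput false 0 ++ [d 0]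
      ++ L.flatMap (linearTape false) := by
    rw [hlen, certificateInput, List.flatMap_def, hL, List.map_ofFn]
    simp only [coeff_single_three_separableCubic, coeff_single_two_separableCubic,
      coeff_single_one_separableCubic, coeff_zero_separableCubic, Fin.sum_univ_one]
    simp [List.ofFn_succ, optionalInput, linearTape, Function.comp_def]
  have hD : (0 : ℤ) < (x 0).den := by exact_mod_cast (x 0).den_pos
  have hx : ((x 0 : ℚ) : ℝ) = (((x 0).num : ℤ) : ℝ) / (((x 0).den : ℤ) : ℝ) := by
    rw [Rat.cast_def]; push_cast; rfl
  rw [hin] at htape ⊢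
  obtain ⟨t, h1, h2⟩ := hK (x 0).num (x 0).den 0 1 (a 0) (b 0) (c 0) 0 0 0 (d 0) L
    ((fun i => (x i : ℝ)) ∈ feasibleSet (separableCubic a b c d) f)
    (fun _ => ⟨rfl, rfl, rfl, rfl, rfl, by simp [hL]⟩) (by
      rw [clearedCubic_nonpos_iff hD one_pos hx (y := 0) (by simp)]
      refine and_congr ?_ ?_
      · rw [aeval_separableCubic, Fin.sum_univ_one]; simp
      · simp only [hL, List.mem_ofFn', Set.forall_mem_range]
        refine forall_congr' fun j => ?_
        rw [clearedLinear_nonpos_iff hD one_pos hx (y := 0) (by simp),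
          aeval_of_totalDegree_le_one (hdeg j), Fin.sum_univ_one]
        simp) B hB htape
  exact ⟨t, h1, hlen ▸ h2⟩

open BitProgram in
theorem exists_decidesIn_two : ∃ K : ℕ, ∀ (m : ℕ) (f : Fin m → MvPolynomial (Fin 2) ℤ)
    (a b c d : Fin 2 → ℤ) (x : Fin 2 → ℚ) (B : ℕ), (∀ j, (f j).totalDegree ≤ 1) → 2 ≤ B →
    (∀ z ∈ certificateInput x (separableCubic a b c d) f, intSize z ≤ B) →
    ∃ t, (verifier true).DecidesIn (certificateInput x (separableCubic a b c d) f)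
        ((fun i => (x i : ℝ)) ∈ feasibleSet (separableCubic a b c d) f) t ∧
      t ≤ (m + 1) * (K * B ^ 2) := by
  obtain ⟨K, hK⟩ := exists_exec_verifier true
  refine ⟨K, fun m f a b c d x B hdeg hB htape => ?_⟩
  set L : List (ℤ × ℤ × ℤ) := List.ofFn fun j => ((f j).coeff (Finsupp.single 0 1),
    (f j).coeff (Finsupp.single 1 1), (f j).coeff 0) with hL
  have hlen : L.length = m := by simp [hL]
  have hin : certificateInput x (separableCubic a b c d) f = [(x 0).num, ((x 0).den : ℤ)]
      ++ optionalInput true (x 1).num ++ optionalInput true (x 1).den ++ [(L.length : ℤ)]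
      ++ [a 0, b 0, c 0] ++ optionalInput true (a 1) ++ optionalInput true (b 1)
      ++ optionalInput true (c 1) ++ [d 0 + d 1] ++ L.flatMap (linearTape true) := by
    rw [hlen, certificateInput, List.flatMap_def, hL, List.map_ofFn]
    simp only [coeff_single_three_separableCubic, coeff_single_two_separableCubic,
      coeff_single_one_separableCubic, coeff_zero_separableCubic, Fin.sum_univ_two]
    simp [List.ofFn_succ, optionalInput, linearTape, Function.comp_def]
  have hD : ∀ i, (0 : ℤ) < (x i).den := fun i => by exact_mod_cast (x i).den_pos
  have hx : ∀ i, ((x i : ℚ) : ℝ) = (((x i).num : ℤ) : ℝ) / (((x i).den : ℤ) : ℝ) := fun i => by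
    rw [Rat.cast_def]; push_cast; rfl
  rw [hin] at htape ⊢
  obtain ⟨t, h1, h2⟩ := hK (x 0).num (x 0).den (x 1).num (x 1).den (a 0) (b 0) (c 0)
    (a 1) (b 1) (c 1) (d 0 + d 1) L
    ((fun i => (x i : ℝ)) ∈ feasibleSet (separableCubic a b c d) f)
    (fun h => by simp at h) (by
      rw [clearedCubic_nonpos_iff (hD 0) (hD 1) (hx 0) (hx 1)]
      refine and_congr ?_ ?_
      · rw [aeval_separableCubic, Fin.sum_univ_two]
        push_cast
        constructor <;> intro h <;> linarith
      · simp only [hL, List.mem_ofFn', Set.forall_mem_range]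
        refine forall_congr' fun j => ?_
        rw [clearedLinear_nonpos_iff (hD 0) (hD 1) (hx 0) (hx 1),
          aeval_of_totalDegree_le_one (hdeg j), Fin.sum_univ_two]) B hB htape
  exact ⟨t, h1, hlen ▸ h2⟩

theorem mainTheorem6 (n : ℕ) (hn : n = 1 ∨ n = 2) :
    ∃ (p : Polynomial ℝ) (q : MvPolynomial (Fin 2) ℝ) (V : BitProgram),
      ∀ (m : ℕ) (f : Fin m → MvPolynomial (Fin n) ℤ) (a b c d : Fin n → ℤ)
        (g : MvPolynomial (Fin n) ℤ) (H : ℝ),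
        (∀ j, (f j).totalDegree = 1) →
        g = separableCubic a b c d →
        (∀ i, a i ≠ 0) →
        CoeffsBoundedBy H g →
        (∀ j, CoeffsBoundedBy H (f j)) →
        ((feasibleSet g f).Nonempty →
          ∃ x : Fin n → ℚ, (fun i => (x i : ℝ)) ∈ feasibleSet g f ∧
            (vecSize x : ℝ) ≤ p.eval (Real.log H)) ∧
        (∀ x : Fin n → ℚ, ∃ t : ℕ,
          V.DecidesIn (certificateInput x g f) ((fun i => (x i : ℝ)) ∈ feasibleSet g f) t ∧
          ((vecSize x : ℝ) ≤ p.eval (Real.log H) →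
            (t : ℝ) ≤ MvPolynomial.eval ![(m : ℝ), Real.log H] q)) := by
  have hsmall : ∀ {m : ℕ} {f : Fin m → MvPolynomial (Fin n) ℤ} {a b c d : Fin n → ℤ} {H : ℤ},
      2 ≤ H → (∀ j, (f j).totalDegree ≤ 1) → (∀ i, a i ≠ 0) →
      (∀ e, |(separableCubic a b c d).coeff e| ≤ H) → (∀ j e, |(f j).coeff e| ≤ H) →
      (feasibleSet (separableCubic a b c d) f).Nonempty →
      ∃ x ∈ feasibleSet (separableCubic a b c d) f, ∀ i, HeightLE (H ^ 410) (x i) := by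
    rcases hn with rfl | rfl
    · exact fun hH hdeg _ => exists_small_real_solution_one hH hdeg
    · exact exists_small_real_solution_two
  obtain ⟨V, K, hV⟩ : ∃ (V : BitProgram) (K : ℕ), ∀ (m : ℕ) (f : Fin m → MvPolynomial (Fin n) ℤ)
      (a b c d : Fin n → ℤ) (x : Fin n → ℚ) (B : ℕ), (∀ j, (f j).totalDegree ≤ 1) → 2 ≤ B →
      (∀ z ∈ certificateInput x (separableCubic a b c d) f, intSize z ≤ B) →
      ∃ t, V.DecidesIn (certificateInput x (separableCubic a b c d) f)
          ((fun i => (x i : ℝ)) ∈ feasibleSet (separableCubic a b c d) f) t ∧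
        t ≤ (m + 1) * (K * B ^ 2) := by
    rcases hn with rfl | rfl
    · exact ⟨_, exists_decidesIn_one⟩
    · exact ⟨_, exists_decidesIn_two⟩
  -- with `s = clog 2 (⌊H⌋ + 1) ≤ 3 + 2 * log H`, small solutions have size at most `1640 * s + 8`,
  -- and the inputs have size at most `vecSize x + m + s + 2`
  refine ⟨Polynomial.C 5000 + Polynomial.C 3280 * Polynomial.X,
    (MvPolynomial.X 0 + 1) * (MvPolynomial.C (K : ℝ) *
      (MvPolynomial.C 5005 + MvPolynomial.X 0 + MvPolynomial.C 3282 * MvPolynomial.X 1) ^ 2),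
    V, ?_⟩
  rintro m f a b c d g H hdeg rfl ha hg hf
  have hn0 : 0 < n := by omega
  -- `H` bounds a nonzero integer, so `log H` is nonnegative
  have hH1 : 1 ≤ H := by
    have h := hg (Finsupp.single ⟨0, hn0⟩ 3)
    rw [coeff_single_three_separableCubic] at h
    have : (1 : ℝ) ≤ |(a ⟨0, hn0⟩ : ℝ)| := by exact_mod_cast Int.one_le_abs (ha _)
    linarith
  have hfl : 1 ≤ ⌊H⌋ := Int.le_floor.2 (by simpa using hH1)
  have hclog := clog_floor_add_one_le hH1
  have hlog := Real.log_nonneg hH1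
  set s := Nat.clog 2 (⌊H⌋ + 1).natAbs with hs
  have hdeg' : ∀ j, (f j).totalDegree ≤ 1 := fun j => (hdeg j).le
  simp only [Polynomial.eval_add, Polynomial.eval_mul, Polynomial.eval_C, Polynomial.eval_X]
  refine ⟨fun hne => ?_, fun x => ?_⟩
  · obtain ⟨y, hy, hyH⟩ := hsmall (H := ⌊H⌋ + 1) (by omega) hdeg' ha
      (fun e => (hg.abs_coeff_le e).trans (by omega))
      (fun j e => ((hf j).abs_coeff_le e).trans (by omega)) hne
    choose x hx hxs using fun i => (hyH i).exists_rat
    refine ⟨x, by rwa [funext hx], ?_⟩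
    have h1 := clog_pow_add_one_le (by omega : 2 ≤ ⌊H⌋ + 1) 410
    have h2 : ∀ i, ratSize (x i) ≤ 820 * s + 3 := fun i => (hxs i).trans (by omega)
    have h3 : vecSize x ≤ 1640 * s + 8 := by
      have h4 := Finset.sum_le_card_nsmul Finset.univ (fun i => ratSize (x i)) _ fun i _ => h2 i
      rw [Finset.card_univ, Fintype.card_fin, smul_eq_mul] at h4
      unfold vecSize
      rcases hn with rfl | rfl <;> omega
    have h4 : (vecSize x : ℝ) ≤ 1640 * s + 8 := by exact_mod_cast h3
    linarith
  · obtain ⟨t, h1, h2⟩ := hV m f a b c d x (vecSize x + m + s + 2) hdeg' (by omega)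
      fun z hz => intSize_le_of_mem_certificateInput hg hf hz
    refine ⟨t, h1, fun hx => ?_⟩
    have h3 : (t : ℝ) ≤ (m + 1) * (K * ((vecSize x : ℝ) + m + s + 2) ^ 2) := by exact_mod_cast h2
    refine h3.trans ?_
    simp only [MvPolynomial.eval_mul, MvPolynomial.eval_add, MvPolynomial.eval_X,
      MvPolynomial.eval_C, map_one, map_pow, Matrix.cons_val_zero, Matrix.cons_val_one]
    have h4 : (vecSize x : ℝ) + m + s + 2 ≤ 5005 + m + 3282 * Real.log H := by linarith
    gcongr ((m : ℝ) + 1) * (K * ?_ ^ 2)
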